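/- **Setting.** There are $K\ge 1$ arms and a horizon of $T\ge 2$ rounds. Let $\nu$ be an arbitrary joint probability distribution of a reward vector $r(\cdot)\in[0,1]^K$ and a delay vector $d(\cdot)\in(\mathbb N\cup\{\infty\})^K$ (rewards and delays may be dependent). The pairs $(r_t(\cdot),d_t(\cdot))$, $t=1,\dots,T$, are i.i.d. with law $\nu$. In round $t$ the agent pulls an arm $a_t$ and gets the reward $r_t(a_t)$, which it observes, together with $a_t$ but without $t$ or the delay, only at the end of round $t+d_t(a_t)$ (never, if the delay is infinite). Let $\mu_i=\mathbb E_\nu[r(i)]$, let $i^*$ be an arm with $\mu_{i^*}=\max_i\mu_i$, let $\Delta_i=\mu_{i^*}-\mu_i$, and for $q\in[0,1]$ let $$d_i(q)=\min\{\gamma\in\mathbb N : \Pr_\nu[d(i)\le\gamma]\ge q\}\in\mathbb N\cup\{\infty\}\qquad(\min\emptyset=\infty).$$ The expected pseudo-regret is $\mathcal R_T=\max_i\mathbb E\big[\sum_{t=1}^T r_t(i)\big]-\mathbb E\big[\sum_{t=1}^T r_t(a_t)\big]$. **Algorithm (Optimistic-Pessimistic Successive Elimination, OPSE).** Start with $S=[K]$,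 $t=1$. Repeat until $T$ rounds have been played: pull each arm of $S$ once (in any order that is fixed in advance for the pass and the set $S$; arms after round $T$ are dropped) and increase $t$ by $|S|$; for $i\in S$ compute $$m_t(i)=\sum_{s<t}\mathbf 1\{a_s=i\},\qquad n_t(i)=\sum_{s:\,s+d_s(a_s)<t}\mathbf 1\{a_s=i\},$$ $$\hat\mu^-_t(i)=\frac1{m_t(i)}\sum_{s:\,s+d_s(a_s)<t}\mathbf 1\{a_s=i\}\,r_s(a_s),\qquad \hat\mu^+_t(i)=\frac{m_t(i)-n_t(i)}{m_t(i)}+\hat\mu_t^-(i),$$ $$LCB_t(i)=\hat\mu^-_t(i)-\sqrt{\frac{2\log T}{m_t(i)}},\qquad UCB_t(i)=\hat\mu^+_t(i)+\sqrt{\frac{2\log T}{m_t(i)}};$$ then remove from $S$ all arms $i$ for which some $j\in S$ has $UCB_t(i)<LCB_t(j)$. **Theorem.** The expected pseudo-regret of OPSE satisfies $$\mathcal R_T\le\sum_{i\ne i^*}\frac{1166\log T}{\Delta_i}+4\log(K)\Big(\max_{i\ne i^*}d_i(q_i)+d_{i^*}(q_{i^*})\Big),$$ where $q_i=1-\Delta_i/4$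 for $i\ne i^*$ and $q_{i^*}=1-\min_{i\ne i^*}\Delta_i/4$. The right-hand side is read in $[0,\infty]$: it is $\infty$ if $\Delta_i=0$ for some $i\neq i^*$, or if $K\ge2$ and one of the quantiles is infinite. For $K=1$ it is $0$. -/

import Mathlib

open MeasureTheory ProbabilityTheory
open scoped ENNReal

noncomputable section

namespace DelayedBandit

/-- What the environment samples in one round: the vector of rewards `r_t(·)` and the vector of
delays `d_t(·)` of the `K` arms; a delay may be infinite. -/
abbrev Outcome (K : ℕ) : Type := (Fin K → ℝ) × (Fin K → ℕ∞)

/-! ### The instance: mean rewards, gaps, quantiles of the delays -/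

/-- Mean reward `μ_i` of arm `i` under the joint reward-delay distribution `ν`. -/
def meanReward {K : ℕ} (ν : Measure (Outcome K)) (i : Fin K) : ℝ := ∫ x, x.1 i ∂ν

/-- `Δ_i = μ_{i*} - μ_i`. -/
def gap {K : ℕ} (ν : Measure (Outcome K)) (istar i : Fin K) : ℝ :=
  meanReward ν istar - meanReward ν i

/-- `min_{i ≠ i*} Δ_i`. -/
def minGap {K : ℕ} (ν : Measure (Outcome K)) (istar : Fin K) : ℝ :=
  ⨅ i : {i : Fin K // i ≠ istar}, gap ν istar i

/-- `d_i(q) = min {γ ∈ ℕ | Pr[D_i ≤ γ] ≥ q}`, which is `∞` if there is no such `γ`. -/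
def delayQuantile {K : ℕ} (ν : Measure (Outcome K)) (i : Fin K) (q : ℝ) : ℕ∞ :=
  ⨅ (γ : ℕ) (_ : q ≤ ν.real {x | x.2 i ≤ (γ : ℕ∞)}), (γ : ℕ∞)

/-! ### Optimistic-Pessimistic Successive Elimination

Rounds are numbered from `0`. If `t` rounds have been played and `a_s` is the arm pulled in
round `s < t`, the feedback of round `s` has been received iff `s + d_s(a_s) < t`. -/

/-- The arms pulled so far, in chronological order (entry `s` is `a_s`, and the length is the
number `t` of rounds played), and the set of active arms. -/
structure OPSEState (K : ℕ) where
  pulls : List (Fin K)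
  active : Finset (Fin K)

/-- `m_t(i)`: the number of pulls of arm `i`. -/
def numPulls {K : ℕ} (l : List (Fin K)) (i : Fin K) : ℕ := l.count i

/-- The rounds in which arm `i` was pulled and whose feedback has been received. -/
def observedRounds {K : ℕ} (x : ℕ → Outcome K) (l : List (Fin K)) (i : Fin K) :
    Finset (Fin l.length) :=
  Finset.univ.filter fun s => l.get s = i ∧ ((s : ℕ) : ℕ∞) + (x s).2 (l.get s) < (l.length : ℕ∞)

/-- `n_t(i)`: the number of observations of arm `i`. -/
def numObserved {K : ℕ} (x : ℕ → Outcome K) (l : List (Fin K)) (i : Fin K) : ℕ :=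
  (observedRounds x l i).card

/-- The pessimistic estimator `μ̂⁻_t(i)`: missing samples count as `0`. -/
def pessimisticMean {K : ℕ} (x : ℕ → Outcome K) (l : List (Fin K)) (i : Fin K) : ℝ :=
  (1 / (numPulls l i : ℝ)) * ∑ s ∈ observedRounds x l i, (x s).1 (l.get s)

/-- The optimistic estimator `μ̂⁺_t(i)`: missing samples count as `1`. -/
def optimisticMean {K : ℕ} (x : ℕ → Outcome K) (l : List (Fin K)) (i : Fin K) : ℝ :=
  ((numPulls l i : ℝ) - (numObserved x l i : ℝ)) / (numPulls l i : ℝ) + pessimisticMean x l i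

/-- `LCB_t(i)`, for horizon `T`. -/
def lcb {K : ℕ} (T : ℕ) (x : ℕ → Outcome K) (l : List (Fin K)) (i : Fin K) : ℝ :=
  pessimisticMean x l i - √(2 * Real.log T / (numPulls l i : ℝ))

/-- `UCB_t(i)`, for horizon `T`. -/
def ucb {K : ℕ} (T : ℕ) (x : ℕ → Outcome K) (l : List (Fin K)) (i : Fin K) : ℝ :=
  optimisticMean x l i + √(2 * Real.log T / (numPulls l i : ℝ))

/-- A rule that tells, for the `p`-th pass through the active set `S`, in which order the arms of
`S` are pulled, each of them once. -/
def IsPullOrder {K : ℕ} (ord : ℕ → Finset (Fin K) → List (Fin K)) : Prop :=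
  ∀ p S, (ord p S).Nodup ∧ ∀ i, i ∈ ord p S ↔ i ∈ S

open Classical in
/-- The elimination step after the pulls `l`: remove from `S` all arms `i` such that some `j ∈ S`
has `UCB_t(i) < LCB_t(j)`. -/
def eliminate {K : ℕ} (T : ℕ) (x : ℕ → Outcome K) (l : List (Fin K)) (S : Finset (Fin K)) :
    Finset (Fin K) :=
  S.filter fun i => ¬ ∃ j ∈ S, ucb T x l i < lcb T x l j

/-- The state after `p` passes; a pass pulls each active arm once and then eliminates. -/
def opseState {K : ℕ} (ord : ℕ → Finset (Fin K) → List (Fin K)) (T : ℕ) (x : ℕ → Outcome K) :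
    ℕ → OPSEState K
  | 0 => ⟨[], Finset.univ⟩
  | p + 1 =>
    let st := opseState ord T x p
    let l := st.pulls ++ ord p st.active
    ⟨l, eliminate T x l st.active⟩

/-- The arm `a_t` pulled in round `t`. The active set never becomes empty, so that at least
`t + 1` rounds are played in `t + 1` passes and the default value `0` is not used. -/
def opseAction {K : ℕ} [NeZero K] (ord : ℕ → Finset (Fin K) → List (Fin K)) (T : ℕ)
    (x : ℕ → Outcome K) (t : ℕ) : Fin K :=
  (opseState ord T x (t + 1)).pulls.getD t 0

/-- The expected pseudo-regret over `T` rounds,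
`max_i E[∑_t r_t(i)] - E[∑_t r_t(a_t)]`, of OPSE run with horizon `T` when round `t` has the
random outcome `X t`. -/
def opseRegret {K : ℕ} [NeZero K] {Ω : Type*} [MeasurableSpace Ω] (P : Measure Ω)
    (X : ℕ → Ω → Outcome K) (ord : ℕ → Finset (Fin K) → List (Fin K)) (T : ℕ) : ℝ :=
  (⨆ i : Fin K, ∫ ω, ∑ t ∈ Finset.range T, (X t ω).1 i ∂P) -
    ∫ ω, ∑ t ∈ Finset.range T, (X t ω).1 (opseAction ord T (fun s => X s ω) t) ∂P

end DelayedBandit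

end

/-! Let `D i` be the delay quantile of arm i, so that a delay exceeds it with probability at most
Δ_i/4; for the optimal arm this probability is at most every Δ_i/4. The pessimistic and optimistic
estimators bracket the empirical mean that full feedback would give (`sum_reward_bounds`), so the
confidence bounds are valid whatever the delays are, and on a concentration event the optimal arm is
never eliminated (`Concentrated.optimal_mem`). The price is the fraction of missing samples.

A missing pull of i has a delay above `D i` or lies in the last `D i` rounds. All passes so far were
at least as long as the current active set S is large, so those rounds hold at most D_i/|S| + 1
pulls of i (`pulls_in_window`, `missing_le`). An arm that survives with m pulls thus satisfies, up
to a constant at the square root, mΔ ≤ √(m log T) + mΔ/2 + (D_i + D_*)/|S| + 2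
(`Concentrated.gap_le_of_mem`), hence mΔ ≤ 900 log T/Δ + 4(D_i + D_*)/|S| (`mul_gap_le`). Here |S|
is at least one plus the number of suboptimal arms that last as long as i, so the sum of 1/|S| over
the suboptimal arms is at most 1/2 + ... + 1/K ≤ log K instead of order K (`sum_inv_card_le_log`).

For the concentration event, whether round t holds one of the first k pulls of an arm is decided by
the rounds before t. An exponential supermartingale then gives Hoeffding's bound with failure
probability T⁻² (`measure_predictable_sum_gt_le`). The union over arms, k ≤ T and two families of
sums fails with probability at most 2K/T; this adds at most 2K to the regret, which the constant
1166 absorbs. -/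

noncomputable section

namespace DelayedBandit

/-! ### Counting the pulls of an arm -/

/-- The rounds `s < t` in which the sequence of actions `a` equals `i`. -/
def pullRounds {K : ℕ} (a : ℕ → Fin K) (t : ℕ) (i : Fin K) : Finset ℕ :=
  (Finset.range t).filter fun s => a s = i

/-- The number of rounds `s < t` in which the sequence of actions `a` equals `i`. -/
def pullCount {K : ℕ} (a : ℕ → Fin K) (t : ℕ) (i : Fin K) : ℕ := (pullRounds a t i).card

lemma mem_pullRounds {K : ℕ} {a : ℕ → Fin K} {t : ℕ} {i : Fin K} {s : ℕ} :
    s ∈ pullRounds a t i ↔ s < t ∧ a s = i := by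
  simp [pullRounds]

lemma pullRounds_mono {K : ℕ} (a : ℕ → Fin K) (i : Fin K) {t t' : ℕ} (h : t ≤ t') :
    pullRounds a t i ⊆ pullRounds a t' i := by
  intro s hs
  rw [mem_pullRounds] at hs ⊢
  exact ⟨hs.1.trans_le h, hs.2⟩

lemma pullCount_mono {K : ℕ} (a : ℕ → Fin K) (i : Fin K) : Monotone fun t => pullCount a t i :=
  fun _ _ h => Finset.card_le_card (pullRounds_mono a i h)

lemma pullCount_succ_of_eq {K : ℕ} {a : ℕ → Fin K} {s : ℕ} {i : Fin K} (h : a s = i) :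
    pullCount a (s + 1) i = pullCount a s i + 1 := by
  have : pullRounds a (s + 1) i = insert s (pullRounds a s i) := by
    ext r
    simp only [mem_pullRounds, Finset.mem_insert]
    constructor
    · rintro ⟨h1, h2⟩
      rcases Nat.lt_succ_iff_lt_or_eq.1 h1 with h1 | h1
      · exact Or.inr ⟨h1, h2⟩
      · exact Or.inl h1
    · rintro (rfl | ⟨h1, h2⟩)
      · exact ⟨Nat.lt_succ_self _, h⟩
      · exact ⟨h1.trans (Nat.lt_succ_self _), h2⟩
  rw [pullCount, this, Finset.card_insert_of_notMem (by simp [mem_pullRounds]), pullCount]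

/-- The rounds `s < n` that hold one of the first `k` pulls of arm `i`. -/
def firstPulls {K : ℕ} (a : ℕ → Fin K) (n : ℕ) (i : Fin K) (k : ℕ) : Finset ℕ :=
  (Finset.range n).filter fun s => a s = i ∧ pullCount a s i < k

/-- Concentration is proved for a deterministic number of pulls; inserting the random pull count of
a round `t` turns it into a statement about all pulls before `t`. -/
lemma firstPulls_eq_pullRounds {K : ℕ} (a : ℕ → Fin K) {n t : ℕ} (h : t ≤ n) (i : Fin K) :
    firstPulls a n i (pullCount a t i) = pullRounds a t i := by
  ext s
  simp only [firstPulls, Finset.mem_filter, Finset.mem_range, mem_pullRounds]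
  constructor
  · rintro ⟨-, h2, h3⟩
    exact ⟨(pullCount_mono a i).reflect_lt h3, h2⟩
  · rintro ⟨h1, h2⟩
    refine ⟨h1.trans_le h, h2, ?_⟩
    have h3 := pullCount_mono a i (Nat.succ_le_of_lt h1)
    simp only [Nat.succ_eq_add_one] at h3
    rw [pullCount_succ_of_eq h2] at h3
    exact h3

lemma card_firstPulls_le {K : ℕ} (a : ℕ → Fin K) (n : ℕ) (i : Fin K) (k : ℕ) :
    (firstPulls a n i k).card ≤ k := by
  induction n with
  | zero => simp [firstPulls]
  | succ n ih =>
    by_cases h : a n = i ∧ pullCount a n i < k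
    · refine (Finset.card_le_card (t := pullRounds a (n + 1) i) fun s hs => ?_).trans ?_
      · simp only [firstPulls, Finset.mem_filter, Finset.mem_range] at hs
        exact mem_pullRounds.2 ⟨hs.1, hs.2.1⟩
      · have := pullCount_succ_of_eq h.1
        rw [pullCount] at this
        omega
    · rwa [firstPulls, Finset.range_add_one, Finset.filter_insert, if_neg h]

lemma count_eq_pullCount {K : ℕ} (l : List (Fin K)) (a : ℕ → Fin K)
    (h : ∀ (s : ℕ) (hs : s < l.length), l[s] = a s) (i : Fin K) :
    l.count i = pullCount a l.length i := by
  have h1 := Fin.card_filter_univ_eq_vector_get_eq_count i (⟨l, rfl⟩ : List.Vector (Fin K) l.length)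
  have h2 : ∀ s : Fin l.length, List.Vector.get (⟨l, rfl⟩ : List.Vector (Fin K) l.length) s = a s :=
    fun s => h s s.2
  simp only [h2] at h1
  rw [pullCount, pullRounds, Finset.card_filter, Finset.sum_range, ← Finset.card_filter, h1]
  rfl

lemma length_pullOrder {K : ℕ} {ord : ℕ → Finset (Fin K) → List (Fin K)} (hord : IsPullOrder ord)
    (p : ℕ) (S : Finset (Fin K)) : (ord p S).length = S.card := by
  rw [← List.toFinset_card_of_nodup (hord p S).1]
  congr 1
  ext i
  rw [List.mem_toFinset, (hord p S).2]

/-! ### Passes, active sets and the window of the last rounds -/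

section Structure

variable {K : ℕ} (ord : ℕ → Finset (Fin K) → List (Fin K)) (T : ℕ)
  (x : ℕ → Outcome K)

/-- The number of rounds played in the first `p` passes. -/
def passLength (p : ℕ) : ℕ := (opseState ord T x p).pulls.length

/-- The set of active arms after `p` passes. -/
def activeArms (p : ℕ) : Finset (Fin K) := (opseState ord T x p).active

lemma pulls_succ (p : ℕ) : (opseState ord T x (p + 1)).pulls =
    (opseState ord T x p).pulls ++ ord p (activeArms ord T x p) := rfl

lemma activeArms_succ (p : ℕ) : activeArms ord T x (p + 1) =
    eliminate T x (opseState ord T x (p + 1)).pulls (activeArms ord T x p) := rfl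

lemma eliminate_subset (l : List (Fin K)) (S : Finset (Fin K)) : eliminate T x l S ⊆ S := by
  classical exact Finset.filter_subset _ _

lemma activeArms_antitone : Antitone (activeArms ord T x) :=
  antitone_nat_of_succ_le fun p => by
    rw [activeArms_succ]; exact eliminate_subset T x _ _

lemma pulls_prefix {p q : ℕ} (h : p ≤ q) :
    (opseState ord T x p).pulls <+: (opseState ord T x q).pulls := by
  induction q, h using Nat.le_induction with
  | base => exact List.prefix_rfl
  | succ q _ ih => exact ih.trans (List.prefix_append _ _)

lemma numObserved_le_numPulls (l : List (Fin K)) (i : Fin K) :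
    numObserved x l i ≤ numPulls l i := by
  have h1 := Fin.card_filter_univ_eq_vector_get_eq_count i (⟨l, rfl⟩ : List.Vector (Fin K) l.length)
  rw [numPulls]
  refine le_trans ?_ h1.le
  rw [numObserved, observedRounds]
  refine Finset.card_le_card fun s hs => ?_
  simp only [Finset.mem_filter, Finset.mem_univ, true_and] at hs ⊢
  exact hs.1

lemma lcb_le_ucb (l : List (Fin K)) (i : Fin K) : lcb T x l i ≤ ucb T x l i := by
  have h : (0 : ℝ) ≤ ((numPulls l i : ℝ) - numObserved x l i) / numPulls l i := by
    refine div_nonneg (sub_nonneg.2 ?_) (Nat.cast_nonneg _)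
    exact_mod_cast numObserved_le_numPulls x l i
  have h2 := Real.sqrt_nonneg (2 * Real.log T / (numPulls l i : ℝ))
  rw [lcb, ucb, optimisticMean]
  linarith

lemma passLength_succ {ord} (hord : IsPullOrder ord) (p : ℕ) :
    passLength ord T x (p + 1) =
    passLength ord T x p + (activeArms ord T x p).card := by
  rw [passLength, pulls_succ, List.length_append, length_pullOrder hord, passLength]

lemma passLength_mono {ord} (hord : IsPullOrder ord) : Monotone (passLength ord T x) :=
  monotone_nat_of_le_succ fun p => by rw [passLength_succ T x hord]; omega

variable [NeZero K]

/-- The arm with the largest lower bound cannot be eliminated, as its upper bound is no smaller. -/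
lemma activeArms_nonempty (p : ℕ) : (activeArms ord T x p).Nonempty := by
  induction p with
  | zero => exact Finset.univ_nonempty
  | succ p ih =>
    obtain ⟨i, hi, hmax⟩ := Finset.exists_max_image _ (lcb T x (opseState ord T x (p + 1)).pulls) ih
    refine ⟨i, ?_⟩
    rw [activeArms_succ, eliminate, Finset.mem_filter]
    refine ⟨hi, ?_⟩
    rintro ⟨j, hj, hlt⟩
    exact absurd ((hmax j hj).trans (lcb_le_ucb T x _ i)) (not_le.2 hlt)

variable {ord} (hord : IsPullOrder ord)

include hord

lemma le_passLength (p : ℕ) : p ≤ passLength ord T x p := by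
  induction p with
  | zero => exact Nat.zero_le _
  | succ p ih =>
    rw [passLength_succ T x hord]
    have := (activeArms_nonempty ord T x p).card_pos
    omega

/-- Passes only append to the list of pulls, so every history that is long enough shows the same arm
in round `s`. -/
lemma getElem_pulls_eq_opseAction (p s : ℕ) (hs : s < (opseState ord T x p).pulls.length) :
    (opseState ord T x p).pulls[s] = opseAction ord T x s := by
  have hs' : s < (opseState ord T x (s + 1)).pulls.length := le_passLength T x hord (s + 1)
  rw [opseAction, List.getD_eq_getElem _ _ hs']
  rcases le_total p (s + 1) with h | h
  · exact (pulls_prefix ord T x h).getElem hs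
  · exact ((pulls_prefix ord T x h).getElem hs').symm

lemma numPulls_pulls (p : ℕ) (i : Fin K) : numPulls (opseState ord T x p).pulls i =
    pullCount (opseAction ord T x) (passLength ord T x p) i :=
  count_eq_pullCount _ _ (getElem_pulls_eq_opseAction T x hord p) i

lemma pullCount_passLength_succ (p : ℕ) (i : Fin K) :
    pullCount (opseAction ord T x) (passLength ord T x (p + 1)) i =
      pullCount (opseAction ord T x) (passLength ord T x p) i +
        if i ∈ activeArms ord T x p then 1 else 0 := by
  rw [← numPulls_pulls T x hord, ← numPulls_pulls T x hord, numPulls, numPulls, pulls_succ,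
    List.count_append]
  congr 1
  split_ifs with h
  · exact List.count_eq_one_of_mem (hord p _).1 (((hord p _).2 i).2 h)
  · exact List.count_eq_zero_of_not_mem fun h' => h (((hord p _).2 i).1 h')

lemma pullCount_passLength_eq_card (p : ℕ) (i : Fin K) :
    pullCount (opseAction ord T x) (passLength ord T x p) i =
      ((Finset.range p).filter fun q => i ∈ activeArms ord T x q).card := by
  induction p with
  | zero => simp [passLength, opseState, pullCount, pullRounds]
  | succ p ih =>
    rw [pullCount_passLength_succ T x hord, ih, Finset.card_filter, Finset.card_filter,
      Finset.sum_range_succ]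

/-- Active sets decrease, so an active arm took part in all earlier passes. The value `q = p + 1` is
allowed because pass `p` is played before its own elimination step. -/
lemma pullCount_passLength_of_mem {p q : ℕ} {i : Fin K} (hi : i ∈ activeArms ord T x p)
    (hq : q ≤ p + 1) : pullCount (opseAction ord T x) (passLength ord T x q) i = q := by
  rw [pullCount_passLength_eq_card T x hord, Finset.filter_true_of_mem, Finset.card_range]
  intro r hr
  exact activeArms_antitone ord T x (by have := Finset.mem_range.1 hr; omega) hi

/-- The number of active arms bounds how often one of them is pulled in the last `D` rounds. -/
lemma pulls_in_window {p : ℕ} {i : Fin K} (hi : i ∈ activeArms ord T x p) (D : ℕ) :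
    (pullCount (opseAction ord T x) (passLength ord T x (p + 1)) i -
      pullCount (opseAction ord T x) (passLength ord T x (p + 1) - D) i - 1) *
        (activeArms ord T x p).card ≤ D := by
  set t := passLength ord T x (p + 1) with ht
  -- Active sets only shrink, so each of the last `j` passes takes at least as many rounds as pass
  -- `p`.
  have hlen : ∀ j, j ≤ p + 1 →
      j * (activeArms ord T x p).card + passLength ord T x (p + 1 - j) ≤ t := by
    intro j hj
    induction j with
    | zero => simp [ht]
    | succ j ih =>
      have h1 := ih (by omega)
      have h2 := passLength_succ T x hord (p + 1 - (j + 1))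
      have h3 : p + 1 - (j + 1) + 1 = p + 1 - j := by omega
      rw [h3] at h2
      have h4 := Finset.card_le_card
        (activeArms_antitone ord T x (show p + 1 - (j + 1) ≤ p by omega))
      rw [Nat.succ_mul]
      omega
  -- `r` is the first pass boundary inside the window of the last `D` rounds. The passes after it
  -- fit into the window; the pass that the window may cut is the subtracted 1.
  have hex : ∃ r, t - D ≤ passLength ord T x r := ⟨p + 1, Nat.sub_le _ _⟩
  set r := Nat.find hex with hr
  have hrle : r ≤ p + 1 := Nat.find_min' hex (Nat.sub_le _ _)
  have hrspec : t - D ≤ passLength ord T x r := Nat.find_spec hex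
  have h1 := hlen (p + 1 - r) (by omega)
  have h2 : p + 1 - (p + 1 - r) = r := by omega
  rw [h2] at h1
  have h3 : pullCount (opseAction ord T x) t i = p + 1 :=
    pullCount_passLength_of_mem T x hord hi le_rfl
  have h4 : r - 1 ≤ pullCount (opseAction ord T x) (t - D) i := by
    rcases Nat.eq_zero_or_pos r with h0 | h0
    · omega
    · have h5 : ¬ t - D ≤ passLength ord T x (r - 1) := Nat.find_min hex (by omega)
      have h6 := pullCount_mono (opseAction ord T x) i (le_of_not_ge h5)
      simp only at h6
      rwa [pullCount_passLength_of_mem T x hord hi (show r - 1 ≤ p + 1 by omega)] at h6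
  refine le_trans (Nat.mul_le_mul_right _ (show _ ≤ p + 1 - r by omega)) ?_
  omega

end Structure

/-! ### Harmonic sum over the ranks of the arms -/

/-- Sorted by decreasing `f`, the summands are at most 1/2, 1/3, ..., 1/(n+1); ties only decrease
them. The induction inserts a minimum of `f`, whose summand involves the whole set and is paid for
by the increment of the logarithm. -/
lemma sum_inv_card_le_log {ι : Type*} [DecidableEq ι] (f : ι → ℕ) (A : Finset ι) :
    ∑ i ∈ A, (1 : ℝ) / ((A.filter fun j => f i ≤ f j).card + 1) ≤ Real.log (A.card + 1) := by
  induction A using Finset.induction_on_min_value f with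
  | empty => simp
  | insert a s ha hmin ih =>
    rw [Finset.sum_insert ha, Finset.card_insert_of_notMem ha]
    have h1 : (insert a s).filter (fun j => f a ≤ f j) = insert a s := by
      refine Finset.filter_true_of_mem fun j hj => ?_
      rcases Finset.mem_insert.1 hj with rfl | hj
      · exact le_rfl
      · exact hmin j hj
    rw [h1, Finset.card_insert_of_notMem ha]
    have h2 : ∑ i ∈ s, (1 : ℝ) / (((insert a s).filter fun j => f i ≤ f j).card + 1) ≤
        ∑ i ∈ s, (1 : ℝ) / ((s.filter fun j => f i ≤ f j).card + 1) := by
      refine Finset.sum_le_sum fun i _ => ?_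
      have : (s.filter fun j => f i ≤ f j).card ≤ ((insert a s).filter fun j => f i ≤ f j).card :=
        Finset.card_le_card (Finset.filter_subset_filter _ (Finset.subset_insert _ _))
      gcongr
    have h3 : (1 : ℝ) / ((s.card + 1 : ℕ) + 1) + Real.log (s.card + 1) ≤
        Real.log ((s.card + 1 : ℕ) + 1) := by
      push_cast
      set n : ℝ := (s.card : ℝ) with hn
      have hn0 : 0 ≤ n := Nat.cast_nonneg _
      have := Real.log_le_sub_one_of_pos (show 0 < (n + 1) / (n + 1 + 1) by positivity)
      rw [Real.log_div (by positivity) (by positivity)] at this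
      have h4 : (n + 1) / (n + 1 + 1) - 1 = - (1 / (n + 1 + 1)) := by field_simp; ring
      linarith
    linarith

/-! ### Missing feedback and the two confidence bounds -/

/-- The rounds `s < t` in which arm `i` was pulled and whose feedback has been received before
round `t`. -/
def observedPulls (a : ℕ → Fin K) (x : ℕ → Outcome K) (t : ℕ) (i : Fin K) : Finset ℕ :=
  (pullRounds a t i).filter fun s => (s : ℕ∞) + (x s).2 i < t

/-- Missing samples count as `0` in the sum of observed rewards and as `1` in its optimistic
version. -/
lemma sum_reward_bounds {K : ℕ} (T : ℕ) (x : ℕ → Outcome K) (a : ℕ → Fin K) {t : ℕ} (ht : t ≤ T)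
    (hr : ∀ s < T, ∀ i, (x s).1 i ∈ Set.Icc (0 : ℝ) 1) (i : Fin K) :
    ∑ s ∈ observedPulls a x t i, (x s).1 i ≤ ∑ s ∈ pullRounds a t i, (x s).1 i ∧
    ∑ s ∈ pullRounds a t i, (x s).1 i ≤ ∑ s ∈ observedPulls a x t i, (x s).1 i +
      ((pullRounds a t i).card - (observedPulls a x t i).card) := by
  have hlt : ∀ s ∈ pullRounds a t i, s < T := fun s hs => (mem_pullRounds.1 hs).1.trans_le ht
  have hsub : observedPulls a x t i ⊆ pullRounds a t i := Finset.filter_subset _ _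
  constructor
  · exact Finset.sum_le_sum_of_subset_of_nonneg hsub fun s hs _ => (hr s (hlt s hs) i).1
  · have h1 : ∑ s ∈ observedPulls a x t i, (1 - (x s).1 i) ≤
        ∑ s ∈ pullRounds a t i, (1 - (x s).1 i) :=
      Finset.sum_le_sum_of_subset_of_nonneg hsub fun s hs _ => by
        linarith [(hr s (hlt s hs) i).2]
    simp only [Finset.sum_sub_distrib, Finset.sum_const, nsmul_eq_mul, mul_one] at h1
    linarith

section Pointwise

variable {K : ℕ} [NeZero K] {ord : ℕ → Finset (Fin K) → List (Fin K)} (T : ℕ)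
  (x : ℕ → Outcome K) (hord : IsPullOrder ord)

include hord

lemma sum_observedRounds (p : ℕ) (i : Fin K) (g : ℕ → Fin K → ℝ) :
    ∑ s ∈ observedRounds x (opseState ord T x p).pulls i,
        g s ((opseState ord T x p).pulls.get s) =
      ∑ s ∈ observedPulls (opseAction ord T x) x (passLength ord T x p) i, g s i := by
  rw [observedRounds, observedPulls, pullRounds, Finset.filter_filter, Finset.sum_filter,
    Finset.sum_filter, Finset.sum_range]
  refine Finset.sum_congr rfl fun s _ => ?_
  have h : (opseState ord T x p).pulls.get s = opseAction ord T x s :=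
    getElem_pulls_eq_opseAction T x hord p s s.2
  rw [h]
  by_cases h1 : opseAction ord T x s = i
  · simp only [h1, true_and]; rfl
  · simp [h1]

lemma numObserved_pulls (p : ℕ) (i : Fin K) :
    numObserved x (opseState ord T x p).pulls i =
      (observedPulls (opseAction ord T x) x (passLength ord T x p) i).card := by
  have := sum_observedRounds T x hord p i fun _ _ => 1
  simp only [Finset.sum_const, nsmul_eq_mul, mul_one] at this
  exact_mod_cast this

/-- The number of pulls of `i` whose feedback is missing after `p` passes. -/
lemma missing_le {p : ℕ} {i : Fin K} (hi : i ∈ activeArms ord T x p) (D : ℕ) :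
    ((pullRounds (opseAction ord T x) (passLength ord T x (p + 1)) i).card : ℝ) -
        (observedPulls (opseAction ord T x) x (passLength ord T x (p + 1)) i).card ≤
      ∑ s ∈ pullRounds (opseAction ord T x) (passLength ord T x (p + 1)) i,
        {y : Outcome K | (D : ℕ∞) < y.2 i}.indicator 1 (x s) +
      (D / (activeArms ord T x p).card + 1) := by
  classical
  set t := passLength ord T x (p + 1)
  set a := opseAction ord T x
  have hcardpos : 0 < (activeArms ord T x p).card := (activeArms_nonempty ord T x p).card_pos
  have hwin := pulls_in_window T x hord hi D
  -- A pull is observed, or has a delay above `D`, or was made within the last `D` rounds: otherwise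
  -- s + d ≤ s + D < t.
  have hsub : pullRounds a t i ⊆ observedPulls a x t i ∪
      ((pullRounds a t i).filter fun s => x s ∈ {y : Outcome K | (D : ℕ∞) < y.2 i}) ∪
        (pullRounds a t i \ pullRounds a (t - D) i) := by
    intro s hs
    simp only [Finset.mem_union, observedPulls, Finset.mem_filter, hs, true_and,
      Set.mem_ofPred_eq, Finset.mem_sdiff]
    by_contra! hcon
    obtain ⟨⟨h1, h2⟩, h3⟩ := hcon
    rw [mem_pullRounds] at h3 hs
    have h4 : s + D < t := by omega
    refine absurd (lt_of_le_of_lt (add_le_add le_rfl h2) ?_) (not_lt.2 h1)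
    exact_mod_cast h4
  have hcard := (Finset.card_le_card hsub).trans ((Finset.card_union_le _ _).trans
    (add_le_add (Finset.card_union_le _ _) le_rfl))
  rw [Finset.card_sdiff_of_subset (pullRounds_mono a i (Nat.sub_le t D))] at hcard
  have hind : ∑ s ∈ pullRounds a t i, {y : Outcome K | (D : ℕ∞) < y.2 i}.indicator (1 : Outcome K → ℝ) (x s)
      = ((pullRounds a t i).filter fun s => x s ∈ {y : Outcome K | (D : ℕ∞) < y.2 i}).card := by
    rw [Finset.card_filter]
    push_cast
    refine Finset.sum_congr rfl fun s _ => ?_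
    simp [Set.indicator_apply]
  have hw : (((pullRounds a t i).card - (pullRounds a (t - D) i).card : ℕ) : ℝ) ≤
      D / (activeArms ord T x p).card + 1 := by
    have h1 : ((((pullRounds a t i).card - (pullRounds a (t - D) i).card - 1 : ℕ) : ℝ)) ≤
        D / (activeArms ord T x p).card := by
      rw [le_div_iff₀ (by exact_mod_cast hcardpos)]
      exact_mod_cast hwin
    have h2 : (((pullRounds a t i).card - (pullRounds a (t - D) i).card : ℕ) : ℝ) ≤
        (((pullRounds a t i).card - (pullRounds a (t - D) i).card - 1 : ℕ) : ℝ) + 1 := by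
      have : (pullRounds a t i).card - (pullRounds a (t - D) i).card ≤
        (pullRounds a t i).card - (pullRounds a (t - D) i).card - 1 + 1 := by omega
      exact_mod_cast this
    linarith
  rw [hind]
  have hcard' : ((pullRounds a t i).card : ℝ) ≤ (observedPulls a x t i).card +
      ((pullRounds a t i).filter fun s => x s ∈ {y : Outcome K | (D : ℕ∞) < y.2 i}).card +
      ((pullRounds a t i).card - (pullRounds a (t - D) i).card : ℕ) := by exact_mod_cast hcard
  linarith

/-- Multiplying by the number of pulls replaces means by sums, to which the concentration bounds
apply, and makes the confidence radius a multiple of their deviation √(m log T). -/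
lemma ucb_pulls (p : ℕ) (i : Fin K) {m : ℕ} (hm0 : 0 < m)
    (hm : pullCount (opseAction ord T x) (passLength ord T x p) i = m) :
    m * ucb T x (opseState ord T x p).pulls i =
      (m - (observedPulls (opseAction ord T x) x (passLength ord T x p) i).card) +
      ∑ s ∈ observedPulls (opseAction ord T x) x (passLength ord T x p) i, (x s).1 i +
      √2 * √(m * Real.log T) := by
  have hm' : (0 : ℝ) < m := by exact_mod_cast hm0
  rw [ucb, optimisticMean, pessimisticMean, numPulls_pulls T x hord, hm,
    numObserved_pulls T x hord, sum_observedRounds T x hord p i fun s j => (x s).1 j]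
  have hs : (m : ℝ) * √(2 * Real.log T / m) = √2 * √(m * Real.log T) := by
    rw [← Real.sqrt_mul (by norm_num)]
    nth_rewrite 1 [← Real.sqrt_sq hm'.le]
    rw [← Real.sqrt_mul (by positivity)]
    congr 1
    field_simp
  rw [mul_add, mul_add, hs]
  field_simp

lemma lcb_pulls (p : ℕ) (i : Fin K) {m : ℕ} (hm0 : 0 < m)
    (hm : pullCount (opseAction ord T x) (passLength ord T x p) i = m) :
    m * lcb T x (opseState ord T x p).pulls i =
      ∑ s ∈ observedPulls (opseAction ord T x) x (passLength ord T x p) i, (x s).1 i -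
      √2 * √(m * Real.log T) := by
  have h1 := ucb_pulls T x hord p i hm0 hm
  have hm' : (m : ℝ) ≠ 0 := by exact_mod_cast hm0.ne'
  have h2 : (m : ℝ) * ucb T x (opseState ord T x p).pulls i +
      m * lcb T x (opseState ord T x p).pulls i =
      (m - (observedPulls (opseAction ord T x) x (passLength ord T x p) i).card) +
      2 * ∑ s ∈ observedPulls (opseAction ord T x) x (passLength ord T x p) i, (x s).1 i := by
    rw [ucb, lcb, optimisticMean, pessimisticMean, numPulls_pulls T x hord, hm,
      numObserved_pulls T x hord, sum_observedRounds T x hord p i fun s j => (x s).1 j]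
    field_simp
    ring
  linarith

end Pointwise

/-! ### Deterministic regret analysis on the concentration event -/

/-- The event on which the rewards lie in `[0, 1]` and the sums of rewards and of indicators of
delays above `D i` over the first `k` pulls of an arm are close to their means. -/
structure Concentrated {K : ℕ} (ν : Measure (Outcome K)) (istar : Fin K) (D : Fin K → ℕ) (T : ℕ)
    (a : ℕ → Fin K) (x : ℕ → Outcome K) : Prop where
  reward_mem : ∀ s < T, ∀ i, (x s).1 i ∈ Set.Icc (0 : ℝ) 1
  reward_upper : ∀ i, i ≠ istar → ∀ k ∈ Finset.Icc 1 T,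
    ∑ s ∈ firstPulls a T i k, ((x s).1 i - meanReward ν i) ≤ √(k * Real.log T)
  reward_lower : ∀ k ∈ Finset.Icc 1 T,
    ∑ s ∈ firstPulls a T istar k, (meanReward ν istar - (x s).1 istar) ≤ √(k * Real.log T)
  delay : ∀ i, ∀ k ∈ Finset.Icc 1 T,
    ∑ s ∈ firstPulls a T i k, ({y : Outcome K | (D i : ℕ∞) < y.2 i}.indicator 1 (x s) -
      ν.real {y : Outcome K | (D i : ℕ∞) < y.2 i}) ≤ √(k * Real.log T)

section Pointwise

variable {K : ℕ} [NeZero K] {ord : ℕ → Finset (Fin K) → List (Fin K)} {T : ℕ}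
  {x : ℕ → Outcome K} (hord : IsPullOrder ord) {ν : Measure (Outcome K)} {istar : Fin K}
  {D : Fin K → ℕ} (hc : Concentrated ν istar D T (opseAction ord T x) x)

include hord hc

lemma Concentrated.sum_reward_le {p : ℕ} (hp : passLength ord T x (p + 1) ≤ T) {i : Fin K}
    (hi : i ∈ activeArms ord T x p) (hne : i ≠ istar) :
    ∑ s ∈ pullRounds (opseAction ord T x) (passLength ord T x (p + 1)) i, (x s).1 i ≤
      (p + 1 : ℕ) * meanReward ν i + √((p + 1 : ℕ) * Real.log T) := by
  have hcount := pullCount_passLength_of_mem T x hord hi le_rfl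
  have h1 := hc.reward_upper i hne (p + 1)
    (Finset.mem_Icc.2 ⟨by omega, (le_passLength T x hord _).trans hp⟩)
  rw [← hcount, firstPulls_eq_pullRounds _ hp, hcount, Finset.sum_sub_distrib, Finset.sum_const,
    nsmul_eq_mul, ← pullCount, hcount] at h1
  linarith

lemma Concentrated.le_sum_reward {p : ℕ} (hp : passLength ord T x (p + 1) ≤ T)
    (hi : istar ∈ activeArms ord T x p) :
    (p + 1 : ℕ) * meanReward ν istar - √((p + 1 : ℕ) * Real.log T) ≤
    ∑ s ∈ pullRounds (opseAction ord T x) (passLength ord T x (p + 1)) istar, (x s).1 istar := by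
  have hcount := pullCount_passLength_of_mem T x hord hi le_rfl
  have h1 := hc.reward_lower (p + 1)
    (Finset.mem_Icc.2 ⟨by omega, (le_passLength T x hord _).trans hp⟩)
  rw [← hcount, firstPulls_eq_pullRounds _ hp, hcount, Finset.sum_sub_distrib, Finset.sum_const,
    nsmul_eq_mul, ← pullCount, hcount] at h1
  linarith

lemma Concentrated.missing_le {p : ℕ} (hp : passLength ord T x (p + 1) ≤ T) {i : Fin K}
    (hi : i ∈ activeArms ord T x p) :
    ((p + 1 : ℕ) : ℝ) -
        (observedPulls (opseAction ord T x) x (passLength ord T x (p + 1)) i).card ≤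
      (p + 1 : ℕ) * ν.real {y : Outcome K | (D i : ℕ∞) < y.2 i} + √((p + 1 : ℕ) * Real.log T) +
      (D i / (activeArms ord T x p).card + 1) := by
  have hcount := pullCount_passLength_of_mem T x hord hi le_rfl
  have h1 := hc.delay i (p + 1)
    (Finset.mem_Icc.2 ⟨by omega, (le_passLength T x hord _).trans hp⟩)
  have h2 := DelayedBandit.missing_le T x hord hi (D i)
  rw [← hcount, firstPulls_eq_pullRounds _ hp, hcount, Finset.sum_sub_distrib, Finset.sum_const,
    nsmul_eq_mul, ← pullCount, hcount] at h1
  rw [← pullCount, hcount] at h2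
  linarith

/-- The optimistic sum of the optimal arm and the pessimistic sum of an arm `j` lie on the right
sides of the full sums. These deviate by at most √(m log T) each, and the two confidence radii, √2
times as large, cover the deviations. -/
lemma Concentrated.optimal_mem (hstar : ∀ i, meanReward ν i ≤ meanReward ν istar) {p : ℕ}
    (hp : passLength ord T x p ≤ T) : istar ∈ activeArms ord T x p := by
  induction p with
  | zero => exact Finset.mem_univ _
  | succ p ih =>
    have hmem := ih ((passLength_mono T x hord (Nat.le_succ p)).trans hp)
    rw [activeArms_succ, eliminate, Finset.mem_filter]
    refine ⟨hmem, ?_⟩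
    rintro ⟨j, hj, hlt⟩
    by_cases hjs : j = istar
    · subst hjs
      exact absurd (lcb_le_ucb T x _ j) (not_le.2 hlt)
    · have hm0 : (0 : ℝ) < (p + 1 : ℕ) := by positivity
      have h1 := ucb_pulls T x hord (p + 1) istar (Nat.succ_pos p)
        (pullCount_passLength_of_mem T x hord hmem le_rfl)
      have h2 := lcb_pulls T x hord (p + 1) j (Nat.succ_pos p)
        (pullCount_passLength_of_mem T x hord hj le_rfl)
      have h3 := (sum_reward_bounds T x (opseAction ord T x) hp hc.reward_mem istar).2
      have h4 := (sum_reward_bounds T x (opseAction ord T x) hp hc.reward_mem j).1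
      have h5 := hc.sum_reward_le hord hp hj hjs
      have h6 := hc.le_sum_reward hord hp hmem
      have h7 := mul_lt_mul_of_pos_left hlt hm0
      have h8 := mul_le_mul_of_nonneg_left (hstar j) hm0.le
      rw [← pullCount, pullCount_passLength_of_mem T x hord hmem le_rfl] at h3
      have h9 : √((p + 1 : ℕ) * Real.log T) ≤ √2 * √((p + 1 : ℕ) * Real.log T) :=
        le_mul_of_one_le_left (Real.sqrt_nonneg _) (Real.one_le_sqrt.2 (by norm_num))
      linarith

/-- Survival means that the upper bound of `i` is not below the lower bound of the optimal arm. In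
the coefficient, 2√2 comes from the two radii, 2 from the two reward deviations and 2 from the
deviations of the two counts of long delays. The final 2 is the rounding of two windows. -/
lemma Concentrated.gap_le_of_mem (hstar : ∀ i, meanReward ν i ≤ meanReward ν istar) {p : ℕ}
    (hp : passLength ord T x (p + 1) ≤ T) {i : Fin K} (hi : i ∈ activeArms ord T x (p + 1))
    (hne : i ≠ istar) :
    (p + 1 : ℕ) * gap ν istar i ≤ (4 + 2 * √2) * √((p + 1 : ℕ) * Real.log T) +
      (p + 1 : ℕ) * (ν.real {y : Outcome K | (D i : ℕ∞) < y.2 i} +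
        ν.real {y : Outcome K | (D istar : ℕ∞) < y.2 istar}) +
      ((D i + D istar : ℕ) / (activeArms ord T x p).card) + 2 := by
  have hs := hc.optimal_mem hord hstar ((passLength_mono T x hord (Nat.le_succ p)).trans hp)
  rw [activeArms_succ, eliminate, Finset.mem_filter] at hi
  obtain ⟨hip, hel⟩ := hi
  have hle : lcb T x (opseState ord T x (p + 1)).pulls istar ≤
      ucb T x (opseState ord T x (p + 1)).pulls i :=
    not_lt.1 fun h => hel ⟨istar, hs, h⟩
  have h1 := ucb_pulls T x hord (p + 1) i (Nat.succ_pos p)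
    (pullCount_passLength_of_mem T x hord hip le_rfl)
  have h2 := lcb_pulls T x hord (p + 1) istar (Nat.succ_pos p)
    (pullCount_passLength_of_mem T x hord hs le_rfl)
  have h3 := (sum_reward_bounds T x (opseAction ord T x) hp hc.reward_mem istar).2
  have h4 := (sum_reward_bounds T x (opseAction ord T x) hp hc.reward_mem i).1
  have h5 := hc.sum_reward_le hord hp hip hne
  have h6 := hc.le_sum_reward hord hp hs
  have h7 := mul_le_mul_of_nonneg_left hle (Nat.cast_nonneg (α := ℝ) (p + 1))
  have h8 := hc.missing_le hord hp hip
  have h9 := hc.missing_le hord hp hs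
  rw [← pullCount, pullCount_passLength_of_mem T x hord hs le_rfl] at h3
  rw [gap, Nat.cast_add (D i), add_div]
  linarith

end Pointwise

/-- If mΔ exceeds 900L/Δ, then √(mL) ≤ mΔ/30, and mΔ ≥ 450 makes the 2 negligible. The right side is
then at most (6.83/30 + 1/2 + 1/225)mΔ + W, and more than a quarter of mΔ remains to be bounded by
`W`. -/
lemma mul_gap_le {m L Δ W : ℝ} (hm : 0 < m) (hL : 1 / 2 ≤ L) (hΔ : 0 < Δ) (hΔ1 : Δ ≤ 1)
    (hW : 0 ≤ W) (h : m * Δ ≤ (4 + 2 * √2) * √(m * L) + m * (Δ / 2) + W + 2) :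
    m * Δ ≤ 900 * L / Δ + 4 * W := by
  have h0 : 0 ≤ 900 * L / Δ := by positivity
  by_cases hcase : m * Δ ≤ 900 * L / Δ
  · linarith
  rw [not_le, div_lt_iff₀ hΔ] at hcase
  have h1 : √(m * L) ≤ m * Δ / 30 := by
    refine Real.sqrt_le_iff.2 ⟨by positivity, ?_⟩
    nlinarith
  have h2 : 2 ≤ m * Δ / 225 := by nlinarith [mul_pos hm hΔ]
  have h3 : √2 ≤ 1.415 := Real.sqrt_le_iff.2 ⟨by norm_num, by norm_num⟩
  have h4 : (4 + 2 * √2) * √(m * L) ≤ 6.83 * (m * Δ / 30) :=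
    mul_le_mul (by linarith) h1 (Real.sqrt_nonneg _) (by norm_num)
  linarith

section Pointwise

variable {K : ℕ} [NeZero K] {ord : ℕ → Finset (Fin K) → List (Fin K)} {T : ℕ}
  {x : ℕ → Outcome K} (hord : IsPullOrder ord) {ν : Measure (Outcome K)} {istar : Fin K}
  {D : Fin K → ℕ} (hc : Concentrated ν istar D T (opseAction ord T x) x)

include hord hc

/-- On the concentration event, the regret due to arm `i` is bounded through its number `P i` of
passes and the arms with at least as many passes. -/
lemma Concentrated.exists_passes (hT : 1 / 2 ≤ Real.log T)
    (hstar : ∀ i, meanReward ν i ≤ meanReward ν istar)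
    (hpos : ∀ i, i ≠ istar → 0 < gap ν istar i ∧ gap ν istar i ≤ 1)
    (hdelay : ∀ i, i ≠ istar → ν.real {y : Outcome K | (D i : ℕ∞) < y.2 i} ≤ gap ν istar i / 4)
    (hdelay' : ∀ i, i ≠ istar →
      ν.real {y : Outcome K | (D istar : ℕ∞) < y.2 istar} ≤ gap ν istar i / 4) :
    ∃ f : Fin K → ℕ, ∀ i, i ≠ istar →
      (pullCount (opseAction ord T x) T i : ℝ) * gap ν istar i ≤
        (900 * Real.log T / gap ν istar i + 1) + 4 * (D i + D istar : ℕ) *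
          (1 / ((((Finset.univ.erase istar).filter fun j => f i ≤ f j).card : ℝ) + 1)) := by
  -- `Q` passes cover the horizon. The last one may run beyond it, which only overcounts pulls; all
  -- earlier boundaries lie before `T`, where the concentration event applies.
  have hex : ∃ q, T ≤ passLength ord T x q := ⟨T, le_passLength T x hord T⟩
  set Q := Nat.find hex with hQ
  have hQT : T ≤ passLength ord T x Q := Nat.find_spec hex
  have hlt : ∀ p < Q, passLength ord T x p < T := fun p hp => not_le.1 (Nat.find_min hex hp)
  -- The passes that contain an arm form an initial segment, so its pull count tells in which passes
  -- it was active.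
  have hiff : ∀ i p, p < pullCount (opseAction ord T x) (passLength ord T x Q) i ↔
      p < Q ∧ i ∈ activeArms ord T x p := by
    intro i p
    rw [pullCount_passLength_eq_card T x hord]
    constructor
    · intro hp
      by_contra hcon
      have hsub : (Finset.range Q).filter (fun q => i ∈ activeArms ord T x q) ⊆
          Finset.range p := by
        intro q hq
        rw [Finset.mem_filter, Finset.mem_range] at hq
        rw [Finset.mem_range]
        by_contra hpq
        exact hcon ⟨by omega, activeArms_antitone ord T x (not_lt.1 hpq) hq.2⟩
      have := Finset.card_le_card hsub
      rw [Finset.card_range] at this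
      omega
    · rintro ⟨h1, h2⟩
      have hsub : Finset.range (p + 1) ⊆
          (Finset.range Q).filter (fun q => i ∈ activeArms ord T x q) := by
        intro q hq
        rw [Finset.mem_range] at hq
        rw [Finset.mem_filter, Finset.mem_range]
        exact ⟨by omega, activeArms_antitone ord T x (by omega) h2⟩
      have := Finset.card_le_card hsub
      rw [Finset.card_range] at this
      omega
  refine ⟨fun i => pullCount (opseAction ord T x) (passLength ord T x Q) i, fun i hi => ?_⟩
  obtain ⟨hΔ, hΔ1⟩ := hpos i hi
  set P := pullCount (opseAction ord T x) (passLength ord T x Q)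
  set c : ℝ := (((Finset.univ.erase istar).filter fun j => P i ≤ P j).card : ℝ) + 1 with hcdef
  have hcpos : 0 < c := by positivity
  have hcount : (pullCount (opseAction ord T x) T i : ℝ) ≤ P i := by
    exact_mod_cast pullCount_mono (opseAction ord T x) i hQT
  have hW : 0 ≤ 4 * ((D i + D istar : ℕ) : ℝ) * (1 / c) := by positivity
  have hL : 0 ≤ 900 * Real.log T / gap ν istar i := by positivity
  refine (mul_le_mul_of_nonneg_right hcount hΔ.le).trans ?_
  by_cases hP1 : P i ≤ 1
  · have : (P i : ℝ) ≤ 1 := by exact_mod_cast hP1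
    nlinarith
  -- An arm with `p + 2` pulls survived the elimination that followed its pull number `p + 1`. The
  -- gap bound is applied there; the one remaining pull costs at most 1.
  obtain ⟨p, hp⟩ : ∃ p, P i = p + 2 := ⟨P i - 2, by omega⟩
  obtain ⟨hpQ, hmem⟩ := (hiff i (p + 1)).1 (by omega)
  have hpT := (hlt _ hpQ).le
  have hsmem := hc.optimal_mem hord hstar hpT
  have hkey := hc.gap_le_of_mem hord hstar hpT hmem hi
  -- Every suboptimal arm with at least as many pulls as `i` was active in pass `p`, and so was the
  -- optimal arm.
  have hcard : c ≤ (activeArms ord T x p).card := by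
    have hsub : insert istar ((Finset.univ.erase istar).filter fun j => P i ≤ P j) ⊆
        activeArms ord T x p := by
      intro j hj
      rcases Finset.mem_insert.1 hj with rfl | hj
      · exact activeArms_antitone ord T x (Nat.le_succ p) hsmem
      · have hj' := (Finset.mem_filter.1 hj).2
        exact ((hiff j p).1 (by omega)).2
    have := Finset.card_le_card hsub
    rw [Finset.card_insert_of_notMem (by simp)] at this
    rw [hcdef]
    exact_mod_cast this
  have hWle : ((D i + D istar : ℕ) : ℝ) / (activeArms ord T x p).card ≤
      ((D i + D istar : ℕ) : ℝ) * (1 / c) := by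
    rw [mul_one_div]
    gcongr
  have hm : (0 : ℝ) < (p + 1 : ℕ) := by positivity
  have h1 := mul_gap_le (W := ((D i + D istar : ℕ) : ℝ) * (1 / c)) hm hT hΔ hΔ1 (by positivity) (by
    have h2 := mul_le_mul_of_nonneg_left (add_le_add (hdelay i hi) (hdelay' i hi)) hm.le
    have h3 : gap ν istar i / 4 + gap ν istar i / 4 = gap ν istar i / 2 := by ring
    rw [h3] at h2
    linarith)
  rw [hp]
  push_cast at h1 ⊢
  linarith

/-- The regret bound on the concentration event. -/
lemma Concentrated.sum_gap_le (hT : 1 / 2 ≤ Real.log T)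
    (hstar : ∀ i, meanReward ν i ≤ meanReward ν istar)
    (hpos : ∀ i, i ≠ istar → 0 < gap ν istar i ∧ gap ν istar i ≤ 1)
    (hdelay : ∀ i, i ≠ istar → ν.real {y : Outcome K | (D i : ℕ∞) < y.2 i} ≤ gap ν istar i / 4)
    (hdelay' : ∀ i, i ≠ istar →
      ν.real {y : Outcome K | (D istar : ℕ∞) < y.2 istar} ≤ gap ν istar i / 4)
    {M : ℕ} (hM : ∀ i, i ≠ istar → D i ≤ M) :
    ∑ s ∈ Finset.range T, gap ν istar (opseAction ord T x s) ≤
      ∑ i ∈ Finset.univ.erase istar, (900 * Real.log T / gap ν istar i + 1) +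
        4 * Real.log K * (M + D istar : ℕ) := by
  obtain ⟨f, hf⟩ := hc.exists_passes hord hT hstar hpos hdelay hdelay'
  have h1 : ∑ s ∈ Finset.range T, gap ν istar (opseAction ord T x s) =
      ∑ i, (pullCount (opseAction ord T x) T i : ℝ) * gap ν istar i := by
    rw [← Finset.sum_fiberwise (Finset.range T) (opseAction ord T x)]
    refine Finset.sum_congr rfl fun i _ => ?_
    rw [Finset.sum_congr rfl (g := fun _ => gap ν istar i)
      (fun s hs => by rw [(Finset.mem_filter.1 hs).2]), Finset.sum_const, nsmul_eq_mul]
    rfl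
  rw [h1, ← Finset.add_sum_erase _ _ (Finset.mem_univ istar)]
  have h2 : gap ν istar istar = 0 := sub_self _
  rw [h2, mul_zero, zero_add]
  have hK : (((Finset.univ.erase istar).card : ℝ) + 1) = K := by
    have := Finset.card_erase_add_one (Finset.mem_univ istar)
    rw [Finset.card_univ, Fintype.card_fin] at this
    exact_mod_cast this
  have h3 := sum_inv_card_le_log f (Finset.univ.erase istar)
  rw [hK] at h3
  calc _ ≤ ∑ i ∈ Finset.univ.erase istar, ((900 * Real.log T / gap ν istar i + 1) +
        4 * (M + D istar : ℕ) *
          (1 / ((((Finset.univ.erase istar).filter fun j => f i ≤ f j).card : ℝ) + 1))) := by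
        refine Finset.sum_le_sum fun i hi => ?_
        have hi' := (Finset.mem_erase.1 hi).1
        refine (hf i hi').trans ?_
        have : ((D i + D istar : ℕ) : ℝ) ≤ (M + D istar : ℕ) := by
          exact_mod_cast Nat.add_le_add_right (hM i hi') _
        gcongr
    _ = ∑ i ∈ Finset.univ.erase istar, (900 * Real.log T / gap ν istar i + 1) +
        4 * (M + D istar : ℕ) * ∑ i ∈ Finset.univ.erase istar,
          (1 / ((((Finset.univ.erase istar).filter fun j => f i ≤ f j).card : ℝ) + 1)) := by
        rw [Finset.sum_add_distrib, Finset.mul_sum]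
    _ ≤ _ := by
        have := mul_le_mul_of_nonneg_left h3
          (show (0 : ℝ) ≤ 4 * (M + D istar : ℕ) by positivity)
        linarith

end Pointwise

/-! ### Hoeffding's inequality for predictable sampling -/

section Predictable

variable {E : Type*}

/-- `G` depends only on the first `n` entries of a sequence. -/
def DependsOnFirst {β : Type*} (n : ℕ) (G : (ℕ → E) → β) : Prop :=
  ∀ x y : ℕ → E, (∀ s < n, x s = y s) → G x = G y

lemma DependsOnFirst.mono {β : Type*} {n m : ℕ} {G : (ℕ → E) → β} (h : DependsOnFirst n G)
    (hnm : n ≤ m) : DependsOnFirst m G :=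
  fun x y hxy => h x y fun s hs => hxy s (hs.trans_le hnm)

variable [MeasurableSpace E] {Ω : Type*} [MeasurableSpace Ω] {P : Measure Ω}

/-- What depends on the rounds before `n` is independent of round `n`. -/
lemma DependsOnFirst.indepFun [Inhabited E] {T : ℕ} {X : ℕ → Ω → E} (hmeas : ∀ t, Measurable (X t))
    (hindep : iIndepFun (fun t : Fin T => X t) P) {β : Type*} [MeasurableSpace β] {n : ℕ}
    (hn : n < T) {G : (ℕ → E) → β} (hG : DependsOnFirst n G) (hGm : Measurable G) :
    IndepFun (fun ω => G fun s => X s ω) (X n) P := by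
  classical
  set S : Finset (Fin T) := Finset.univ.filter fun s => (s : ℕ) < n with hS
  have hdisj : Disjoint S {(⟨n, hn⟩ : Fin T)} := by simp [hS]
  have h := hindep.indepFun_finset S {(⟨n, hn⟩ : Fin T)} hdisj fun i => hmeas i
  -- The entries from `n` on are filled with a default value, which `G` does not read.
  let ext : (S → E) → ℕ → E := fun y s =>
    if hs : s < n then y ⟨⟨s, hs.trans hn⟩, by simp [hS, hs]⟩ else default
  have hext : Measurable ext := by
    refine measurable_pi_lambda _ fun s => ?_
    by_cases hs : s < n
    · simp only [ext, hs, dif_pos]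
      exact measurable_pi_apply _
    · simp only [ext, hs, dif_neg, not_false_iff]
      exact measurable_const
  have h2 := h.comp (hGm.comp hext)
    (measurable_pi_apply (⟨⟨n, hn⟩, Finset.mem_singleton_self _⟩ : ({⟨n, hn⟩} : Finset (Fin T))))
  convert h2 using 1
  · funext ω
    refine hG _ _ fun s hs => ?_
    simp [ext, hs]
  · rfl

/-- Hoeffding's lemma: a variable in [0, 1] is sub-Gaussian with variance proxy 1/4, which gives the
correction l²/8. -/
lemma lintegral_exp_centered_le {ν : Measure E} [IsProbabilityMeasure ν] {f : E → ℝ}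
    (hf : Measurable f) (hf01 : ∀ᵐ y ∂ν, f y ∈ Set.Icc (0 : ℝ) 1) (l : ℝ) :
    ∫⁻ y, ENNReal.ofReal (Real.exp (l * (f y - ∫ z, f z ∂ν) - l ^ 2 / 8)) ∂ν ≤ 1 := by
  have h := hasSubgaussianMGF_of_mem_Icc hf.aemeasurable hf01
  have h1 := h.mgf_le l
  have h2 := h.integrable_exp_mul l
  rw [← ofReal_integral_eq_lintegral_ofReal]
  · rw [ENNReal.ofReal_le_one]
    simp only [Real.exp_sub]
    rw [integral_div, div_le_one (Real.exp_pos _)]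
    refine h1.trans (Real.exp_le_exp.2 (le_of_eq ?_))
    simp
    ring
  · simp only [Real.exp_sub]
    exact h2.div_const _
  · exact Filter.Eventually.of_forall fun y => (Real.exp_pos _).le

/-- The exponential supermartingale of centered samples in predictable rounds. -/
lemma lintegral_exp_predictable_sum_le [Inhabited E] [IsProbabilityMeasure P] {ν : Measure E}
    [IsProbabilityMeasure ν] {T : ℕ} {X : ℕ → Ω → E} (hmeas : ∀ t, Measurable (X t))
    (hlaw : ∀ t < T, P.map (X t) = ν) (hindep : iIndepFun (fun t : Fin T => X t) P)
    {f : E → ℝ} (hf : Measurable f) (hf01 : ∀ᵐ y ∂ν, f y ∈ Set.Icc (0 : ℝ) 1)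
    {b : ℕ → (ℕ → E) → ℝ} (hb : ∀ t x, b t x = 0 ∨ b t x = 1) (hbm : ∀ t, Measurable (b t))
    (hbd : ∀ t, DependsOnFirst t (b t)) (l : ℝ) {n : ℕ} (hn : n ≤ T) :
    ∫⁻ ω, ENNReal.ofReal (Real.exp (∑ t ∈ Finset.range n, b t (fun s => X s ω) *
      (l * (f (X t ω) - ∫ z, f z ∂ν) - l ^ 2 / 8))) ∂P ≤ 1 := by
  induction n with
  | zero => simp
  | succ n ih =>
    have hXm : Measurable fun ω s => X s ω := measurable_pi_lambda _ hmeas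
    set W : (ℕ → E) → ℝ≥0∞ := fun x => ENNReal.ofReal (Real.exp (∑ t ∈ Finset.range n, b t x *
      (l * (f (x t) - ∫ z, f z ∂ν) - l ^ 2 / 8))) with hW
    set e : E → ℝ≥0∞ := fun y =>
      ENNReal.ofReal (Real.exp (l * (f y - ∫ z, f z ∂ν) - l ^ 2 / 8)) with he
    have hWm : Measurable W := by
      refine (Real.measurable_exp.comp (Finset.measurable_sum _ fun t _ => ?_)).ennreal_ofReal
      have := hf.comp (measurable_pi_apply (X := fun _ : ℕ => E) t)
      exact (hbm t).mul (((this.sub_const _).const_mul l).sub_const _)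
    have hem : Measurable e := by
      have := hf
      exact (Real.measurable_exp.comp
        (((this.sub_const _).const_mul l).sub_const _)).ennreal_ofReal
    have hWd : DependsOnFirst n W := by
      intro x y hxy
      simp only [hW]
      congr 2
      refine Finset.sum_congr rfl fun t ht => ?_
      have ht' := Finset.mem_range.1 ht
      rw [hxy t ht', hbd t x y fun s hs => hxy s (hs.trans ht')]
    -- Split by whether round `n` is selected. If not, the new factor is 1; if so, it is independent
    -- of the past and has mean at most 1.
    set G : (ℕ → E) → ℝ≥0∞ := fun x => W x * ENNReal.ofReal (b n x) with hG
    set G' : (ℕ → E) → ℝ≥0∞ := fun x => W x * ENNReal.ofReal (1 - b n x) with hG'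
    have hGm : Measurable G := hWm.mul (hbm n).ennreal_ofReal
    have hGm' : Measurable G' := hWm.mul ((hbm n).const_sub 1).ennreal_ofReal
    have hGX : Measurable fun ω => G' fun s => X s ω := hGm'.comp hXm
    have hGd : DependsOnFirst n G := fun x y hxy => by
      simp only [hG]; rw [hWd x y hxy, hbd n x y hxy]
    have hind := hGd.indepFun hmeas hindep (by omega) hGm
    have hind' := hind.comp measurable_id hem
    have hsplit : ∀ ω, ENNReal.ofReal (Real.exp (∑ t ∈ Finset.range (n + 1),
        b t (fun s => X s ω) * (l * (f (X t ω) - ∫ z, f z ∂ν) - l ^ 2 / 8))) =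
        G' (fun s => X s ω) + G (fun s => X s ω) * e (X n ω) := by
      intro ω
      rw [Finset.sum_range_succ, Real.exp_add, ENNReal.ofReal_mul (Real.exp_pos _).le]
      simp only [hG, hG', hW, he]
      rcases hb n (fun s => X s ω) with h | h <;> simp [h]
    have hsum : ∀ ω, G' (fun s => X s ω) + G (fun s => X s ω) = W (fun s => X s ω) := by
      intro ω
      simp only [hG, hG']
      rcases hb n (fun s => X s ω) with h | h <;> simp [h]
    simp only [hsplit]
    rw [lintegral_add_left hGX]
    have hprod : ∫⁻ ω, G (fun s => X s ω) * e (X n ω) ∂P =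
        (∫⁻ ω, G (fun s => X s ω) ∂P) * ∫⁻ ω, e (X n ω) ∂P :=
      lintegral_mul_eq_lintegral_mul_lintegral_of_indepFun'' (hGm.comp hXm).aemeasurable
        (hem.comp (hmeas n)).aemeasurable hind'
    have he1 : ∫⁻ ω, e (X n ω) ∂P ≤ 1 := by
      rw [← lintegral_map hem (hmeas n), hlaw n (by omega)]
      exact lintegral_exp_centered_le hf hf01 l
    calc _ ≤ ∫⁻ ω, G' (fun s => X s ω) ∂P + ∫⁻ ω, G (fun s => X s ω) ∂P := by
          rw [hprod]
          gcongr
          exact mul_le_of_le_one_right' he1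
      _ = ∫⁻ ω, W (fun s => X s ω) ∂P := by
          rw [← lintegral_add_left hGX]
          exact lintegral_congr hsum
      _ ≤ 1 := ih (by omega)

/-- Hoeffding's inequality for the samples in at most `k` predictable rounds. -/
lemma measure_predictable_sum_gt_le [Inhabited E] [IsProbabilityMeasure P] {ν : Measure E}
    [IsProbabilityMeasure ν] {T : ℕ} (hT : 1 ≤ T) {X : ℕ → Ω → E} (hmeas : ∀ t, Measurable (X t))
    (hlaw : ∀ t < T, P.map (X t) = ν) (hindep : iIndepFun (fun t : Fin T => X t) P)
    {f : E → ℝ} (hf : Measurable f) (hf01 : ∀ᵐ y ∂ν, f y ∈ Set.Icc (0 : ℝ) 1)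
    {b : ℕ → (ℕ → E) → ℝ} (hb : ∀ t x, b t x = 0 ∨ b t x = 1) (hbm : ∀ t, Measurable (b t))
    (hbd : ∀ t, DependsOnFirst t (b t)) {k : ℕ} (hk : 0 < k)
    (hbk : ∀ x, ∑ t ∈ Finset.range T, b t x ≤ k) :
    P {ω | √(k * Real.log T) < ∑ t ∈ Finset.range T, b t (fun s => X s ω) *
      (f (X t ω) - ∫ z, f z ∂ν)} ≤ ENNReal.ofReal (1 / (T : ℝ) ^ 2) := by
  have hk' : (0 : ℝ) < k := by exact_mod_cast hk
  have hT' : (1 : ℝ) ≤ T := by exact_mod_cast hT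
  have hL : 0 ≤ Real.log T := Real.log_nonneg hT'
  set u : ℝ := √(k * Real.log T) with hu
  have hu0 : 0 ≤ u := Real.sqrt_nonneg _
  have hu2 : u ^ 2 = k * Real.log T := Real.sq_sqrt (by positivity)
  -- This maximizes lu - l²k/8, with value 2u²/k = 2 log T; Markov's inequality then gives the bound
  -- T⁻².
  set l : ℝ := 4 * u / k with hl
  have hl0 : 0 ≤ l := by positivity
  have hXm : Measurable fun ω s => X s ω := measurable_pi_lambda _ hmeas
  have h1 := lintegral_exp_predictable_sum_le hmeas hlaw hindep hf hf01 hb hbm hbd l le_rfl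
  have hexp : Real.exp (2 * Real.log T) = (T : ℝ) ^ 2 := by
    rw [mul_comm, Real.exp_mul, Real.exp_log (by linarith)]
    norm_num
  set g : Ω → ℝ≥0∞ := fun ω => ENNReal.ofReal (Real.exp (∑ t ∈ Finset.range T,
    b t (fun s => X s ω) * (l * (f (X t ω) - ∫ z, f z ∂ν) - l ^ 2 / 8))) with hg
  have hgm : Measurable g := by
    refine (Real.measurable_exp.comp (Finset.measurable_sum _ fun t _ => ?_)).ennreal_ofReal
    exact ((hbm t).comp hXm).mul ((((hf.comp (hmeas t)).sub_const _).const_mul l).sub_const _)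
  have h2 := mul_meas_ge_le_lintegral (μ := P) hgm (ENNReal.ofReal ((T : ℝ) ^ 2))
  have hsub : {ω | u < ∑ t ∈ Finset.range T, b t (fun s => X s ω) *
      (f (X t ω) - ∫ z, f z ∂ν)} ⊆ {ω | ENNReal.ofReal ((T : ℝ) ^ 2) ≤ g ω} := by
    intro ω hω
    simp only [Set.mem_ofPred_eq] at hω ⊢
    refine ENNReal.ofReal_le_ofReal ?_
    rw [← hexp, Real.exp_le_exp]
    have h3 : ∑ t ∈ Finset.range T, b t (fun s => X s ω) *
        (l * (f (X t ω) - ∫ z, f z ∂ν) - l ^ 2 / 8) =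
        l * ∑ t ∈ Finset.range T, b t (fun s => X s ω) * (f (X t ω) - ∫ z, f z ∂ν) -
          l ^ 2 / 8 * ∑ t ∈ Finset.range T, b t (fun s => X s ω) := by
      rw [Finset.mul_sum, Finset.mul_sum, ← Finset.sum_sub_distrib]
      exact Finset.sum_congr rfl fun t _ => by ring
    rw [h3]
    have h4 := mul_le_mul_of_nonneg_left hω.le hl0
    have h5 := mul_le_mul_of_nonneg_left (hbk fun s => X s ω)
      (show 0 ≤ l ^ 2 / 8 by positivity)
    have h6 : l * u - l ^ 2 / 8 * k = 2 * u ^ 2 / k := by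
      rw [hl]; field_simp; ring
    have h7 : 2 * u ^ 2 / k = 2 * Real.log T := by rw [hu2]; field_simp
    linarith
  have h8 : ENNReal.ofReal ((T : ℝ) ^ 2) * P {ω | ENNReal.ofReal ((T : ℝ) ^ 2) ≤ g ω} ≤ 1 :=
    h2.trans h1
  refine (measure_mono hsub).trans ?_
  rw [one_div, ENNReal.ofReal_inv_of_pos (by positivity), ← one_div, ENNReal.le_div_iff_mul_le
    (Or.inl (by simp; linarith)) (Or.inl ENNReal.ofReal_ne_top), mul_comm]
  exact h8

end Predictable

/-! ### Predictability and measurability of the actions -/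

lemma pullCount_congr {K : ℕ} {a b : ℕ → Fin K} {t : ℕ} (h : ∀ s < t, a s = b s) (i : Fin K) :
    pullCount a t i = pullCount b t i := by
  rw [pullCount, pullCount]
  congr 1
  refine Finset.filter_congr fun s hs => ?_
  rw [h s (Finset.mem_range.1 hs)]

section Measurability

variable {K : ℕ} (T : ℕ)

lemma observedRounds_congr {x y : ℕ → Outcome K} {l : List (Fin K)}
    (h : ∀ s < l.length, x s = y s) (i : Fin K) :
    observedRounds x l i = observedRounds y l i := by
  refine Finset.filter_congr fun s _ => ?_
  rw [h s s.2]

lemma pessimisticMean_congr {x y : ℕ → Outcome K} {l : List (Fin K)}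
    (h : ∀ s < l.length, x s = y s) (i : Fin K) :
    pessimisticMean x l i = pessimisticMean y l i := by
  rw [pessimisticMean, pessimisticMean, observedRounds_congr h]
  congr 1
  exact Finset.sum_congr rfl fun s _ => by rw [h s s.2]

lemma eliminate_congr {x y : ℕ → Outcome K} {l : List (Fin K)}
    (h : ∀ s < l.length, x s = y s) (S : Finset (Fin K)) :
    eliminate T x l S = eliminate T y l S := by
  have h1 : ∀ i, ucb T x l i = ucb T y l i := fun i => by
    rw [ucb, ucb, optimisticMean, optimisticMean, numObserved, numObserved,
      observedRounds_congr h, pessimisticMean_congr h]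
  have h2 : ∀ i, lcb T x l i = lcb T y l i := fun i => by
    rw [lcb, lcb, pessimisticMean_congr h]
  simp only [eliminate, h1, h2]

variable (ord : ℕ → Finset (Fin K) → List (Fin K))

/-- Passes may extend beyond round `t`, so the states themselves can differ. They can do so only
after a common history of more than `t` pulls, which already fixes the arm of round `t`. -/
lemma opseState_congr {x y : ℕ → Outcome K} {t : ℕ} (h : ∀ s < t, x s = y s) (p : ℕ) :
    opseState ord T x p = opseState ord T y p ∨
      ∃ l : List (Fin K), t < l.length ∧ l <+: (opseState ord T x p).pulls ∧
        l <+: (opseState ord T y p).pulls := by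
  induction p with
  | zero => exact Or.inl rfl
  | succ p ih =>
    rcases ih with ih | ⟨l, hl, h1, h2⟩
    · have hpulls : (opseState ord T x (p + 1)).pulls = (opseState ord T y (p + 1)).pulls := by
        rw [pulls_succ, pulls_succ, activeArms, activeArms, ih]
      by_cases hlen : t < (opseState ord T x (p + 1)).pulls.length
      · exact Or.inr ⟨_, hlen, List.prefix_rfl, by rw [← hpulls]⟩
      · have hact : (opseState ord T x (p + 1)).active = (opseState ord T y (p + 1)).active := by
          have e1 := activeArms_succ ord T x p
          have e2 := activeArms_succ ord T y p
          rw [activeArms, activeArms] at e1 e2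
          rw [e1, e2, ← hpulls, ih]
          exact eliminate_congr T (fun s hs => h s (by omega)) _
        left
        cases hx : opseState ord T x (p + 1)
        cases hy : opseState ord T y (p + 1)
        rw [hx, hy] at hpulls hact
        simp only at hpulls hact
        rw [hpulls, hact]
    · exact Or.inr ⟨l, hl, h1.trans (List.prefix_append _ _), h2.trans (List.prefix_append _ _)⟩

lemma dependsOnFirst_opseAction [NeZero K] (t : ℕ) :
    DependsOnFirst t fun x => opseAction ord T x t := by
  intro x y h
  simp only [opseAction]
  rcases opseState_congr T ord h (t + 1) with h1 | ⟨l, hl, h1, h2⟩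
  · rw [h1]
  · rw [List.getD_eq_getElem _ _ (hl.trans_le h1.length_le),
      List.getD_eq_getElem _ _ (hl.trans_le h2.length_le), ← h1.getElem hl, ← h2.getElem hl]

lemma measurableSet_mem_observedRounds (l : List (Fin K)) (i : Fin K) (s : Fin l.length) :
    MeasurableSet {x : ℕ → Outcome K | s ∈ observedRounds x l i} := by
  have hm : Measurable fun x : ℕ → Outcome K => (x s).2 (l.get s) :=
    (measurable_pi_apply _).comp (measurable_snd.comp (measurable_pi_apply _))
  have : {x : ℕ → Outcome K | s ∈ observedRounds x l i} =
      (fun x : ℕ → Outcome K => (x s).2 (l.get s)) ⁻¹'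
        {d | l.get s = i ∧ ((s : ℕ) : ℕ∞) + d < (l.length : ℕ∞)} := by
    ext x
    simp [observedRounds]
  rw [this]
  exact hm (MeasurableSet.of_discrete)

lemma measurable_numObserved (l : List (Fin K)) (i : Fin K) :
    Measurable fun x : ℕ → Outcome K => (numObserved x l i : ℝ) := by
  classical
  have : (fun x : ℕ → Outcome K => (numObserved x l i : ℝ)) = fun x => ∑ s : Fin l.length,
      {x : ℕ → Outcome K | s ∈ observedRounds x l i}.indicator (fun _ => (1 : ℝ)) x := by
    funext x
    simp [numObserved, Set.indicator_apply]
  rw [this]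
  exact Finset.measurable_sum _ fun s _ =>
    measurable_const.indicator (measurableSet_mem_observedRounds l i s)

lemma measurable_pessimisticMean (l : List (Fin K)) (i : Fin K) :
    Measurable fun x : ℕ → Outcome K => pessimisticMean x l i := by
  classical
  have : (fun x : ℕ → Outcome K => pessimisticMean x l i) = fun x => (1 / (numPulls l i : ℝ)) *
      ∑ s : Fin l.length, {x : ℕ → Outcome K | s ∈ observedRounds x l i}.indicator
        (fun x => (x s).1 (l.get s)) x := by
    funext x
    simp only [pessimisticMean, Set.indicator_apply, Set.mem_ofPred_eq]
    rw [← Finset.sum_filter]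
    simp
  rw [this]
  refine (Finset.measurable_sum _ fun s _ => ?_).const_mul _
  refine Measurable.indicator ?_ (measurableSet_mem_observedRounds l i s)
  exact (measurable_pi_apply _).comp (measurable_fst.comp (measurable_pi_apply _))

lemma measurable_lcb (l : List (Fin K)) (i : Fin K) :
    Measurable fun x : ℕ → Outcome K => lcb T x l i :=
  (measurable_pessimisticMean l i).sub_const _

lemma measurable_ucb (l : List (Fin K)) (i : Fin K) :
    Measurable fun x : ℕ → Outcome K => ucb T x l i :=
  ((((measurable_numObserved l i).const_sub _).div_const _).add
    (measurable_pessimisticMean l i)).add_const _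

lemma measurableSet_eliminate_eq (l : List (Fin K)) (S A : Finset (Fin K)) :
    MeasurableSet {x : ℕ → Outcome K | eliminate T x l S = A} := by
  have : {x : ℕ → Outcome K | eliminate T x l S = A} =
      ⋂ i, {x | (i ∈ S ∧ ¬ ∃ j, j ∈ S ∧ ucb T x l i < lcb T x l j) ↔ i ∈ A} := by
    ext x
    simp only [Set.mem_ofPred_eq, Set.mem_iInter, Finset.ext_iff, eliminate, Finset.mem_filter]
  rw [this]
  refine MeasurableSet.iInter fun i => ?_
  have h : ∀ j, MeasurableSet {x : ℕ → Outcome K | ucb T x l i < lcb T x l j} := fun j =>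
    measurableSet_lt (measurable_ucb T l i) (measurable_lcb T l j)
  have hex : MeasurableSet {x : ℕ → Outcome K | ∃ j, j ∈ S ∧ ucb T x l i < lcb T x l j} := by
    have : {x : ℕ → Outcome K | ∃ j, j ∈ S ∧ ucb T x l i < lcb T x l j} =
        ⋃ j, {_x | j ∈ S} ∩ {x | ucb T x l i < lcb T x l j} := by
      ext x
      simp
    rw [this]
    exact MeasurableSet.iUnion fun j => (MeasurableSet.const _).inter (h j)
  have h1 : MeasurableSet
      {x : ℕ → Outcome K | i ∈ S ∧ ¬ ∃ j, j ∈ S ∧ ucb T x l i < lcb T x l j} :=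
    (MeasurableSet.const _).inter hex.compl
  by_cases hA : i ∈ A
  · simpa only [hA, iff_true] using h1
  · simp only [hA, iff_false]
    exact h1.compl

/-- Reduces measurability to countable unions over the possible states; for a fixed history the
confidence bounds are explicit measurable functions. -/
instance : Countable (OPSEState K) :=
  Function.Injective.countable (f := fun st : OPSEState K => (st.pulls, st.active))
    fun s t h => by
      cases s
      cases t
      simpa using h

lemma measurableSet_opseState_eq (p : ℕ) (st : OPSEState K) :
    MeasurableSet {x : ℕ → Outcome K | opseState ord T x p = st} := by
  induction p generalizing st with
  | zero => exact MeasurableSet.const ((⟨[], Finset.univ⟩ : OPSEState K) = st)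
  | succ p ih =>
    have : {x : ℕ → Outcome K | opseState ord T x (p + 1) = st} =
        ⋃ st' : OPSEState K, {x | opseState ord T x p = st'} ∩
          ({_x | st'.pulls ++ ord p st'.active = st.pulls} ∩
            {x | eliminate T x (st'.pulls ++ ord p st'.active) st'.active = st.active}) := by
      ext x
      simp only [Set.mem_ofPred_eq, Set.mem_iUnion, Set.mem_inter_iff]
      constructor
      · rintro rfl
        exact ⟨_, rfl, rfl, rfl⟩
      · rintro ⟨st', h1, h2, h3⟩
        subst h1
        cases st
        simp only at h2 h3
        rw [opseState, ← h2, ← h3]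
    rw [this]
    exact MeasurableSet.iUnion fun st' => (ih st').inter
      ((MeasurableSet.const _).inter (measurableSet_eliminate_eq T _ _ _))

lemma measurable_opseAction [NeZero K] (t : ℕ) :
    Measurable fun x : ℕ → Outcome K => opseAction ord T x t := by
  refine measurable_to_countable' fun i => ?_
  have : (fun x : ℕ → Outcome K => opseAction ord T x t) ⁻¹' {i} =
      ⋃ st : OPSEState K, {x | opseState ord T x (t + 1) = st} ∩ {_x | st.pulls.getD t 0 = i} := by
    ext x
    simp [opseAction]
  rw [this]
  exact MeasurableSet.iUnion fun st =>
    (measurableSet_opseState_eq T ord _ _).inter (MeasurableSet.const _)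

variable [NeZero K]

/-- The indicator that round `t` holds one of the first `k` pulls of arm `i`. -/
def firstPullIndicator (i : Fin K) (k t : ℕ) (x : ℕ → Outcome K) : ℝ :=
  if opseAction ord T x t = i ∧ pullCount (opseAction ord T x) t i < k then 1 else 0

lemma firstPullIndicator_eq (i : Fin K) (k t : ℕ) (x : ℕ → Outcome K) :
    firstPullIndicator T ord i k t x = 0 ∨ firstPullIndicator T ord i k t x = 1 := by
  rw [firstPullIndicator]
  split_ifs <;> simp

lemma sum_firstPulls (i : Fin K) (k n : ℕ) (x : ℕ → Outcome K) (g : ℕ → ℝ) :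
    ∑ s ∈ firstPulls (opseAction ord T x) n i k, g s =
      ∑ s ∈ Finset.range n, firstPullIndicator T ord i k s x * g s := by
  rw [firstPulls, Finset.sum_filter]
  refine Finset.sum_congr rfl fun s _ => ?_
  rw [firstPullIndicator]
  split_ifs <;> simp

lemma sum_firstPullIndicator_le (i : Fin K) (k n : ℕ) (x : ℕ → Outcome K) :
    ∑ s ∈ Finset.range n, firstPullIndicator T ord i k s x ≤ k := by
  have h := sum_firstPulls T ord i k n x fun _ => 1
  simp only [mul_one, Finset.sum_const, nsmul_eq_mul] at h
  rw [← h]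
  exact_mod_cast card_firstPulls_le _ _ _ _

lemma dependsOnFirst_firstPullIndicator (i : Fin K) (k t : ℕ) :
    DependsOnFirst t (firstPullIndicator T ord i k t) := by
  intro x y h
  have h1 : ∀ s ≤ t, opseAction ord T x s = opseAction ord T y s := fun s hs =>
    (dependsOnFirst_opseAction T ord s).mono hs x y h
  rw [firstPullIndicator, firstPullIndicator, h1 t le_rfl,
    pullCount_congr fun s hs => h1 s hs.le]

lemma measurable_firstPullIndicator (i : Fin K) (k t : ℕ) :
    Measurable (firstPullIndicator T ord i k t) := by
  have h1 : Measurable fun x : ℕ → Outcome K => pullCount (opseAction ord T x) t i := by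
    have : (fun x : ℕ → Outcome K => pullCount (opseAction ord T x) t i) =
        fun x => ∑ s ∈ Finset.range t, if opseAction ord T x s = i then 1 else 0 := by
      funext x
      rw [pullCount, pullRounds, Finset.card_filter]
    rw [this]
    exact Finset.measurable_sum _ fun s _ => Measurable.ite
      (measurable_opseAction T ord s (measurableSet_singleton i)) measurable_const measurable_const
  exact Measurable.ite ((measurable_opseAction T ord t (measurableSet_singleton i)).inter
    (measurableSet_lt h1 measurable_const)) measurable_const measurable_const

end Measurability

/-! ### Mean rewards and delay quantiles of the instance -/

section Instance

variable {K : ℕ} {ν : Measure (Outcome K)} [IsProbabilityMeasure ν]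

lemma measurable_reward (i : Fin K) : Measurable fun y : Outcome K => y.1 i :=
  (measurable_pi_apply i).comp measurable_fst

lemma measurable_delay (i : Fin K) : Measurable fun y : Outcome K => y.2 i :=
  (measurable_pi_apply i).comp measurable_snd

lemma measurableSet_delay_gt (i : Fin K) (D : ℕ) :
    MeasurableSet {y : Outcome K | (D : ℕ∞) < y.2 i} :=
  measurable_delay i (MeasurableSet.of_discrete (s := {d : ℕ∞ | (D : ℕ∞) < d}))

lemma integrable_reward (hreward : ∀ᵐ x ∂ν, ∀ i, x.1 i ∈ Set.Icc (0 : ℝ) 1) (i : Fin K) :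
    Integrable (fun y : Outcome K => y.1 i) ν :=
  Integrable.of_mem_Icc 0 1 (measurable_reward i).aemeasurable (hreward.mono fun _ h => h i)

lemma meanReward_mem (hreward : ∀ᵐ x ∂ν, ∀ i, x.1 i ∈ Set.Icc (0 : ℝ) 1) (i : Fin K) :
    meanReward ν i ∈ Set.Icc (0 : ℝ) 1 := by
  constructor
  · exact integral_nonneg_of_ae (hreward.mono fun _ h => (h i).1)
  · have := integral_mono_ae (integrable_reward hreward i) (integrable_const (1 : ℝ))
      (hreward.mono fun _ h => (h i).2)
    simpa [meanReward] using this

lemma delay_gt_toNat_le {i : Fin K} {q : ℝ} (h : delayQuantile ν i q ≠ ⊤) :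
    ν.real {y : Outcome K | ((delayQuantile ν i q).toNat : ℕ∞) < y.2 i} ≤ 1 - q := by
  -- A finite quantile is an attained minimum, found here by `Nat.find`.
  have hq : q ≤ ν.real {y : Outcome K | y.2 i ≤ delayQuantile ν i q} := by
    by_contra hcon
    have hex : ∃ γ : ℕ, q ≤ ν.real {x : Outcome K | x.2 i ≤ (γ : ℕ∞)} := by
      by_contra! hno
      refine h ?_
      rw [delayQuantile]
      simp [not_le.2 (hno _)]
    have hfind : delayQuantile ν i q = (Nat.find hex : ℕ) := by
      refine le_antisymm (iInf₂_le (Nat.find hex) (Nat.find_spec hex)) (le_iInf₂ fun γ hγ => ?_)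
      exact_mod_cast Nat.find_min' hex hγ
    rw [hfind] at hcon
    exact absurd (Nat.find_spec hex) hcon
  rw [ENat.natCast_toNat h]
  have hm : MeasurableSet {y : Outcome K | y.2 i ≤ delayQuantile ν i q} :=
    measurable_delay i (MeasurableSet.of_discrete (s := {d : ℕ∞ | d ≤ delayQuantile ν i q}))
  have hcompl : {y : Outcome K | delayQuantile ν i q < y.2 i} =
      {y : Outcome K | y.2 i ≤ delayQuantile ν i q}ᶜ := by
    ext y
    simp
  rw [hcompl, probReal_compl_eq_one_sub hm]
  linarith

end Instance

/-! ### From the concentration event to the expected regret -/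

lemma opseRegret_congr {K : ℕ} [NeZero K] {T : ℕ} {Ω : Type*} [MeasurableSpace Ω]
    {P : Measure Ω} {ord : ℕ → Finset (Fin K) → List (Fin K)} {X Y : ℕ → Ω → Outcome K} (h : ∀ t < T, X t = Y t) :
    opseRegret P X ord T = opseRegret P Y ord T := by
  have h1 : ∀ ω, ∀ t ∈ Finset.range T,
      opseAction ord T (fun s => X s ω) t = opseAction ord T (fun s => Y s ω) t :=
    fun ω t ht => dependsOnFirst_opseAction T ord t _ _ fun s hs => by
      rw [h s (hs.trans (Finset.mem_range.1 ht))]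
  rw [opseRegret, opseRegret]
  congr 1
  · refine congrArg _ (funext fun i => integral_congr_ae (Filter.Eventually.of_forall fun ω => ?_))
    exact Finset.sum_congr rfl fun t ht => by rw [h t (Finset.mem_range.1 ht)]
  · refine integral_congr_ae (Filter.Eventually.of_forall fun ω => ?_)
    exact Finset.sum_congr rfl fun t ht => by rw [h1 ω t ht, h t (Finset.mem_range.1 ht)]

section Regret

variable {K : ℕ} [NeZero K] {T : ℕ} {ν : Measure (Outcome K)} [IsProbabilityMeasure ν]
  {Ω : Type*} [MeasurableSpace Ω] {P : Measure Ω} [IsProbabilityMeasure P]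
  {X : ℕ → Ω → Outcome K} {istar : Fin K} {ord : ℕ → Finset (Fin K) → List (Fin K)}

/-- The pseudo-regret is the expected sum of the gaps of the pulled arms. -/
lemma opseRegret_eq (hreward : ∀ᵐ x ∂ν, ∀ i, x.1 i ∈ Set.Icc (0 : ℝ) 1)
    (hmeas : ∀ t, Measurable (X t)) (hlaw : ∀ t < T, P.map (X t) = ν)
    (hindep : iIndepFun (fun t : Fin T => X t) P)
    (hstar : ∀ i, meanReward ν i ≤ meanReward ν istar) :
    opseRegret P X ord T =
      ∫ ω, ∑ t ∈ Finset.range T, gap ν istar (opseAction ord T (fun s => X s ω) t) ∂P := by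
  classical
  have hXm : Measurable fun ω s => X s ω := measurable_pi_lambda _ hmeas
  have hint : ∀ t < T, ∀ i, Integrable (fun ω => (X t ω).1 i) P := by
    intro t ht i
    have h := integrable_reward hreward i
    rw [← hlaw t ht] at h
    exact h.comp_measurable (hmeas t)
  have hmean : ∀ t < T, ∀ i, ∫ ω, (X t ω).1 i ∂P = meanReward ν i := by
    intro t ht i
    rw [meanReward, ← hlaw t ht,
      integral_map (hmeas t).aemeasurable (measurable_reward i).aestronglyMeasurable]
  have hsum : ∀ i, ∫ ω, ∑ t ∈ Finset.range T, (X t ω).1 i ∂P = T * meanReward ν i := by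
    intro i
    rw [integral_finsetSum _ fun t ht => hint t (Finset.mem_range.1 ht) i,
      Finset.sum_congr rfl fun t ht => hmean t (Finset.mem_range.1 ht) i]
    simp
  have hsup : (⨆ i : Fin K, ∫ ω, ∑ t ∈ Finset.range T, (X t ω).1 i ∂P) =
      T * meanReward ν istar := by
    simp only [hsum]
    refine le_antisymm (ciSup_le fun i => ?_) ?_
    · exact mul_le_mul_of_nonneg_left (hstar i) (Nat.cast_nonneg _)
    · exact le_ciSup (f := fun i => (T : ℝ) * meanReward ν i) (Set.finite_range _).bddAbove istar
  set a : ℕ → Ω → Fin K := fun t ω => opseAction ord T (fun s => X s ω) t with ha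
  have ham : ∀ t, Measurable (a t) := fun t => (measurable_opseAction T ord t).comp hXm
  have hbind : ∀ t i, Integrable (fun ω => if a t ω = i then (1 : ℝ) else 0) P := by
    intro t i
    refine Integrable.of_mem_Icc 0 1 (Measurable.ite (ham t (measurableSet_singleton i))
      measurable_const measurable_const).aemeasurable (Filter.Eventually.of_forall fun ω => ?_)
    split_ifs <;> simp
  have hprodint : ∀ t < T, ∀ i,
      Integrable (fun ω => (if a t ω = i then (1 : ℝ) else 0) * (X t ω).1 i) P := by
    intro t ht i
    have : (fun ω => (if a t ω = i then (1 : ℝ) else 0) * (X t ω).1 i) =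
        (a t ⁻¹' {i}).indicator fun ω => (X t ω).1 i := by
      funext ω
      simp [Set.indicator_apply]
    rw [this]
    exact (hint t ht i).indicator (ham t (measurableSet_singleton i))
  have hsplit : ∀ t ω, (X t ω).1 (a t ω) =
      ∑ i, (if a t ω = i then (1 : ℝ) else 0) * (X t ω).1 i := by
    intro t ω
    simp
  have hsplit' : ∀ t ω, meanReward ν (a t ω) =
      ∑ i, (if a t ω = i then (1 : ℝ) else 0) * meanReward ν i := by
    intro t ω
    simp
  have hkey : ∀ t < T, ∫ ω, (X t ω).1 (a t ω) ∂P = ∫ ω, meanReward ν (a t ω) ∂P := by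
    intro t ht
    simp only [hsplit, hsplit']
    rw [integral_finsetSum _ fun i _ => hprodint t ht i,
      integral_finsetSum _ fun i _ => (hbind t i).mul_const _]
    refine Finset.sum_congr rfl fun i _ => ?_
    rw [integral_mul_const, ← hmean t ht i]
    -- The arm of round `t` is a function of earlier rounds, hence independent of the reward vector
    -- of round `t`.
    have hind := (dependsOnFirst_opseAction T ord t).indepFun hmeas hindep ht
      (measurable_opseAction T ord t)
    have hφ : Measurable fun j : Fin K => if j = i then (1 : ℝ) else 0 := measurable_of_countable _
    have h := (hind.comp hφ (measurable_reward i)).integral_mul_eq_mul_integral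
      (hφ.comp (ham t)).aestronglyMeasurable
      ((measurable_reward i).comp (hmeas t)).aestronglyMeasurable
    exact h
  have hrint : ∀ t < T, Integrable (fun ω => (X t ω).1 (a t ω)) P := by
    intro t ht
    simp only [hsplit]
    exact integrable_finsetSum _ fun i _ => hprodint t ht i
  have hmint : ∀ t, Integrable (fun ω => meanReward ν (a t ω)) P := by
    intro t
    simp only [hsplit']
    exact integrable_finsetSum _ fun i _ => (hbind t i).mul_const _
  rw [opseRegret, hsup, integral_finsetSum _ fun t ht => hrint t (Finset.mem_range.1 ht),
    Finset.sum_congr rfl fun t ht => hkey t (Finset.mem_range.1 ht)]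
  simp only [gap, Finset.sum_sub_distrib, Finset.sum_const, Finset.card_range, nsmul_eq_mul]
  rw [integral_sub (integrable_const _) (integrable_finsetSum _ fun t _ => hmint t),
    integral_finsetSum _ fun t _ => hmint t]
  simp

/-- Union bound over `K` arms, `T` values of `k` and two families of sums, each event having
probability at most T⁻². -/
lemma measure_not_concentrated_le (hT : 1 ≤ T)
    (hreward : ∀ᵐ x ∂ν, ∀ i, x.1 i ∈ Set.Icc (0 : ℝ) 1)
    (hmeas : ∀ t, Measurable (X t)) (hlaw : ∀ t < T, P.map (X t) = ν)
    (hindep : iIndepFun (fun t : Fin T => X t) P) (D : Fin K → ℕ) :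
    P {ω | ¬ Concentrated ν istar D T (opseAction ord T fun s => X s ω) (fun s => X s ω)} ≤
      ENNReal.ofReal (2 * K / T) := by
  classical
  set N : Set Ω := {ω | ¬ ∀ s < T, ∀ i, (X s ω).1 i ∈ Set.Icc (0 : ℝ) 1} with hN
  have hN0 : P N = 0 := by
    have : ∀ᵐ ω ∂P, ∀ s < T, ∀ i, (X s ω).1 i ∈ Set.Icc (0 : ℝ) 1 := by
      rw [ae_all_iff]
      intro s
      by_cases hs : s < T
      · rw [← hlaw s hs] at hreward
        filter_upwards [ae_of_ae_map (hmeas s).aemeasurable hreward] with ω hω _ using hω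
      · exact Filter.Eventually.of_forall fun ω h => absurd h hs
    exact this
  -- Only upper deviations of suboptimal arms and lower deviations of the optimal arm are needed.
  -- Reflecting the reward of the latter makes both upper deviations and leaves one event per arm
  -- and `k`.
  set f : Fin K → Outcome K → ℝ := fun i y => if i = istar then 1 - y.1 i else y.1 i with hf
  set g : Fin K → Outcome K → ℝ :=
    fun i => {y : Outcome K | (D i : ℕ∞) < y.2 i}.indicator 1 with hg
  have hfm : ∀ i, Measurable (f i) := by
    intro i
    by_cases hi : i = istar
    · simp only [hf, hi, if_true]
      exact (measurable_reward istar).const_sub 1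
    · simp only [hf, hi, if_false]
      exact measurable_reward i
  have hgm : ∀ i, Measurable (g i) := fun i =>
    measurable_one.indicator (measurableSet_delay_gt i (D i))
  have hf01 : ∀ i, ∀ᵐ y ∂ν, f i y ∈ Set.Icc (0 : ℝ) 1 := by
    intro i
    filter_upwards [hreward] with y hy
    have := hy i
    by_cases hi : i = istar
    · rw [hi] at this
      simp only [hf, hi, if_true]
      exact ⟨by linarith [this.2], by linarith [this.1]⟩
    · simp only [hf, hi, if_false]
      exact this
  have hg01 : ∀ i, ∀ᵐ y ∂ν, g i y ∈ Set.Icc (0 : ℝ) 1 := by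
    intro i
    refine Filter.Eventually.of_forall fun y => ?_
    simp only [hg, Set.indicator_apply, Pi.one_apply]
    split_ifs <;> simp
  have hfmean : ∀ i, i ≠ istar → ∫ y, f i y ∂ν = meanReward ν i := by
    intro i hi
    simp only [hf, hi, if_false, meanReward]
  have hfmean' : ∫ y, f istar y ∂ν = 1 - meanReward ν istar := by
    simp only [hf, if_true, meanReward]
    rw [integral_sub (integrable_const _) (integrable_reward hreward istar)]
    simp
  have hgmean : ∀ i, ∫ y, g i y ∂ν = ν.real {y : Outcome K | (D i : ℕ∞) < y.2 i} :=
    fun i => integral_indicator_one (measurableSet_delay_gt i (D i))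
  set A : (Fin K → Outcome K → ℝ) → Fin K → ℕ → Set Ω := fun h i k =>
    {ω | √(k * Real.log T) < ∑ t ∈ Finset.range T,
      firstPullIndicator T ord i k t (fun s => X s ω) * (h i (X t ω) - ∫ z, h i z ∂ν)} with hA
  have hAle : ∀ h : Fin K → Outcome K → ℝ, (∀ i, Measurable (h i)) →
      (∀ i, ∀ᵐ y ∂ν, h i y ∈ Set.Icc (0 : ℝ) 1) → ∀ i, ∀ k ∈ Finset.Icc 1 T,
      P (A h i k) ≤ ENNReal.ofReal (1 / (T : ℝ) ^ 2) := by
    intro h hhm hh01 i k hk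
    exact measure_predictable_sum_gt_le hT hmeas hlaw hindep (hhm i) (hh01 i)
      (firstPullIndicator_eq T ord i k) (measurable_firstPullIndicator T ord i k)
      (dependsOnFirst_firstPullIndicator T ord i k) (Finset.mem_Icc.1 hk).1
      (sum_firstPullIndicator_le T ord i k T)
  have hsub : {ω | ¬ Concentrated ν istar D T (opseAction ord T fun s => X s ω)
      (fun s => X s ω)} ⊆
      N ∪ ⋃ i ∈ (Finset.univ : Finset (Fin K)), ⋃ k ∈ Finset.Icc 1 T, (A f i k ∪ A g i k) := by
    intro ω hω
    by_contra hcon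
    simp only [Set.mem_union, Set.mem_iUnion, Finset.mem_univ, exists_prop, true_and, not_or,
      not_exists, not_and] at hcon
    obtain ⟨hcN, hcA⟩ := hcon
    refine hω ⟨not_not.1 hcN, fun i hi k hk => ?_, fun k hk => ?_, fun i k hk => ?_⟩
    · have h1 := (hcA i k hk).1
      simp only [hA, Set.mem_ofPred_eq, not_lt, hfmean i hi] at h1
      rw [sum_firstPulls]
      simpa only [hf, hi, if_false] using h1
    · have h1 := (hcA istar k hk).1
      simp only [hA, Set.mem_ofPred_eq, not_lt, hfmean'] at h1
      rw [sum_firstPulls]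
      simpa only [hf, if_true, sub_sub_sub_cancel_left] using h1
    · have h1 := (hcA i k hk).2
      simp only [hA, Set.mem_ofPred_eq, not_lt, hgmean] at h1
      rw [sum_firstPulls]
      exact h1
  have hT' : (0 : ℝ) < T := by exact_mod_cast hT
  calc _ ≤ P N + ∑ i : Fin K, ∑ k ∈ Finset.Icc 1 T, (P (A f i k) + P (A g i k)) := by
        refine (measure_mono hsub).trans ((measure_union_le _ _).trans ?_)
        gcongr
        refine (measure_biUnion_finset_le _ _).trans (Finset.sum_le_sum fun i _ => ?_)
        exact (measure_biUnion_finset_le _ _).trans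
          (Finset.sum_le_sum fun k _ => measure_union_le _ _)
    _ ≤ 0 + ∑ _i : Fin K, ∑ _k ∈ Finset.Icc 1 T,
        (ENNReal.ofReal (1 / (T : ℝ) ^ 2) + ENNReal.ofReal (1 / (T : ℝ) ^ 2)) := by
        rw [hN0]
        gcongr with i _ k hk
        · exact hAle f hfm hf01 i k hk
        · exact hAle g hgm hg01 i k hk
    _ = ENNReal.ofReal (2 * K / T) := by
        rw [← ENNReal.ofReal_add (by positivity) (by positivity)]
        simp only [Finset.sum_const, Finset.card_univ, Fintype.card_fin, Nat.card_Icc,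
          add_tsub_cancel_right, zero_add]
        rw [← ENNReal.ofReal_nsmul, ← ENNReal.ofReal_nsmul]
        congr 1
        simp only [nsmul_eq_mul]
        field_simp
        ring

/-- The expected regret exceeds a bound that holds on the concentration event by at most `2K`. -/
lemma opseRegret_le_of_concentrated (hT : 1 ≤ T)
    (hreward : ∀ᵐ x ∂ν, ∀ i, x.1 i ∈ Set.Icc (0 : ℝ) 1)
    (hmeas : ∀ t, Measurable (X t)) (hlaw : ∀ t < T, P.map (X t) = ν)
    (hindep : iIndepFun (fun t : Fin T => X t) P)
    (hstar : ∀ i, meanReward ν i ≤ meanReward ν istar) (D : Fin K → ℕ) {B : ℝ} (hB0 : 0 ≤ B)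
    (hB : ∀ x : ℕ → Outcome K, Concentrated ν istar D T (opseAction ord T x) x →
      ∑ t ∈ Finset.range T, gap ν istar (opseAction ord T x t) ≤ B) :
    opseRegret P X ord T ≤ B + 2 * K := by
  have hXm : Measurable fun ω s => X s ω := measurable_pi_lambda _ hmeas
  have hT' : (0 : ℝ) < T := by exact_mod_cast hT
  rw [opseRegret_eq hreward hmeas hlaw hindep hstar]
  have hgap : ∀ i, gap ν istar i ∈ Set.Icc (0 : ℝ) 1 := fun i =>
    ⟨sub_nonneg.2 (hstar i), by
      have h1 := (meanReward_mem hreward istar).2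
      have h2 := (meanReward_mem hreward i).1
      rw [gap]
      linarith⟩
  set R : Ω → ℝ := fun ω =>
    ∑ t ∈ Finset.range T, gap ν istar (opseAction ord T (fun s => X s ω) t) with hR
  have hRT : ∀ ω, R ω ∈ Set.Icc (0 : ℝ) T := by
    intro ω
    refine ⟨Finset.sum_nonneg fun t _ => (hgap _).1, ?_⟩
    have := Finset.sum_le_sum fun t (_ : t ∈ Finset.range T) =>
      (hgap (opseAction ord T (fun s => X s ω) t)).2
    simpa using this
  have hRm : Measurable R := Finset.measurable_sum _ fun t _ =>
    (measurable_of_countable (gap ν istar)).comp ((measurable_opseAction T ord t).comp hXm)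
  have hRi : Integrable R P :=
    Integrable.of_mem_Icc 0 T hRm.aemeasurable (Filter.Eventually.of_forall hRT)
  -- The regret is at most `T` on this event. Its measurable hull has the same measure, so
  -- measurability of the event itself is not needed.
  set Bad := {ω | ¬ Concentrated ν istar D T (opseAction ord T fun s => X s ω)
    (fun s => X s ω)} with hBad
  have hbad := measure_not_concentrated_le (istar := istar) (ord := ord) hT hreward hmeas hlaw
    hindep D
  have hbad' : P.real (toMeasurable P Bad) ≤ 2 * K / T := by
    rw [measureReal_def, measure_toMeasurable]
    exact ENNReal.toReal_le_of_le_ofReal (by positivity) hbad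
  have hind : Integrable ((toMeasurable P Bad).indicator fun _ => (T : ℝ)) P :=
    (integrable_const _).indicator (measurableSet_toMeasurable _ _)
  calc ∫ ω, R ω ∂P ≤ ∫ ω, (B + (toMeasurable P Bad).indicator (fun _ => (T : ℝ)) ω) ∂P := by
        refine integral_mono hRi ((integrable_const _).add hind) fun ω => ?_
        by_cases hω : ω ∈ toMeasurable P Bad
        · simp only [Set.indicator_of_mem hω]
          linarith [(hRT ω).2]
        · simp only [Set.indicator_of_notMem hω, add_zero]
          exact hB _ (not_not.1 fun h => hω (subset_toMeasurable P Bad h))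
    _ = B + P.real (toMeasurable P Bad) * T := by
        rw [integral_add (integrable_const _) hind,
          integral_indicator_const _ (measurableSet_toMeasurable _ _)]
        simp
    _ ≤ B + 2 * K / T * T := by gcongr
    _ = B + 2 * K := by field_simp

/-- The regret bound in real numbers, for positive gaps and finite delay thresholds. -/
lemma opseRegret_le (hK : 2 ≤ K) (hT : 2 ≤ T)
    (hreward : ∀ᵐ x ∂ν, ∀ i, x.1 i ∈ Set.Icc (0 : ℝ) 1)
    (hmeas : ∀ t, Measurable (X t)) (hlaw : ∀ t < T, P.map (X t) = ν)
    (hindep : iIndepFun (fun t : Fin T => X t) P)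
    (hstar : ∀ i, meanReward ν i ≤ meanReward ν istar) (hord : IsPullOrder ord)
    (hpos : ∀ i, i ≠ istar → 0 < gap ν istar i) {D : Fin K → ℕ}
    (hdelay : ∀ i, i ≠ istar → ν.real {y : Outcome K | (D i : ℕ∞) < y.2 i} ≤ gap ν istar i / 4)
    (hdelay' : ∀ i, i ≠ istar →
      ν.real {y : Outcome K | (D istar : ℕ∞) < y.2 istar} ≤ gap ν istar i / 4)
    {M : ℕ} (hM : ∀ i, i ≠ istar → D i ≤ M) :
    opseRegret P X ord T ≤ ∑ i ∈ Finset.univ.erase istar, 1166 * Real.log T / gap ν istar i +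
      4 * Real.log K * (M + D istar : ℕ) := by
  have hL : 1 / 2 ≤ Real.log T := by
    have h1 : Real.log 2 ≤ Real.log T := Real.log_le_log (by norm_num) (by exact_mod_cast hT)
    linarith [Real.log_two_gt_d9]
  have hpos' : ∀ i, i ≠ istar → 0 < gap ν istar i ∧ gap ν istar i ≤ 1 := fun i hi =>
    ⟨hpos i hi, by
      have h1 := (meanReward_mem hreward istar).2
      have h2 := (meanReward_mem hreward i).1
      rw [gap]
      linarith⟩
  have hlogK : 0 ≤ Real.log K := Real.log_natCast_nonneg K
  have h := opseRegret_le_of_concentrated (istar := istar) (P := P) (ord := ord) (by omega) hreward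
    hmeas hlaw hindep hstar D
    (B := ∑ i ∈ Finset.univ.erase istar, (900 * Real.log T / gap ν istar i + 1) +
      4 * Real.log K * (M + D istar : ℕ))
    (by
      refine add_nonneg (Finset.sum_nonneg fun i hi => ?_) (by positivity)
      have := hpos i (Finset.mem_erase.1 hi).1
      positivity)
    fun x hx => hx.sum_gap_le hord hL hstar hpos' hdelay hdelay' hM
  refine h.trans ?_
  -- For K ≥ 2 the cost 2K of the failure event is at most 4(K - 1), that is, 4 per suboptimal arm.
  have hcard : (2 : ℝ) * K ≤ ∑ _i ∈ Finset.univ.erase istar, (4 : ℝ) := by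
    have h1 := Finset.card_erase_add_one (Finset.mem_univ istar)
    rw [Finset.card_univ, Fintype.card_fin] at h1
    rw [Finset.sum_const, nsmul_eq_mul]
    have h2 : 2 * K ≤ (Finset.univ.erase istar).card * 4 := by omega
    exact_mod_cast h2
  have hterm : ∑ i ∈ Finset.univ.erase istar, ((900 * Real.log T / gap ν istar i + 1) + 4) ≤
      ∑ i ∈ Finset.univ.erase istar, 1166 * Real.log T / gap ν istar i := by
    refine Finset.sum_le_sum fun i hi => ?_
    obtain ⟨h1, h2⟩ := hpos' i (Finset.mem_erase.1 hi).1
    -- The 5 is this 4 plus the 1 for the last pull; 266 = 1166 - 900 leaves ample room, since log T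
    -- ≥ 1/2 and Δ ≤ 1.
    have h3 : 5 ≤ 266 * Real.log T / gap ν istar i := by
      rw [le_div_iff₀ h1]
      linarith
    have h4 : 1166 * Real.log T / gap ν istar i =
        900 * Real.log T / gap ν istar i + 266 * Real.log T / gap ν istar i := by ring
    linarith
  rw [Finset.sum_add_distrib] at hterm
  linarith

end Regret

end DelayedBandit

end

/-! ### The theorem in extended nonnegative reals -/

theorem mainTheorem2 {K : ℕ} [NeZero K] {T : ℕ} (hT : 2 ≤ T)
    (ν : Measure (DelayedBandit.Outcome K)) [IsProbabilityMeasure ν]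
    (hreward : ∀ᵐ x ∂ν, ∀ i, x.1 i ∈ Set.Icc (0 : ℝ) 1)
    {Ω : Type*} [MeasurableSpace Ω] (P : Measure Ω) [IsProbabilityMeasure P]
    (X : ℕ → Ω → DelayedBandit.Outcome K)
    (hmeas : ∀ t < T, Measurable (X t))
    (hlaw : ∀ t < T, P.map (X t) = ν)
    (hindep : iIndepFun (fun t : Fin T => X t) P)
    (istar : Fin K)
    (hstar : ∀ i, DelayedBandit.meanReward ν i ≤ DelayedBandit.meanReward ν istar)
    (ord : ℕ → Finset (Fin K) → List (Fin K)) (hord : DelayedBandit.IsPullOrder ord) :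
    ENNReal.ofReal (DelayedBandit.opseRegret P X ord T) ≤
      (∑ i ∈ Finset.univ.erase istar,
        ENNReal.ofReal (1166 * Real.log T) / ENNReal.ofReal (DelayedBandit.gap ν istar i)) +
      ENNReal.ofReal (4 * Real.log K) *
        (((⨆ (i : Fin K) (_ : i ≠ istar),
            DelayedBandit.delayQuantile ν i (1 - DelayedBandit.gap ν istar i / 4) : ℕ∞) : ℝ≥0∞) +
          (DelayedBandit.delayQuantile ν istar (1 - DelayedBandit.minGap ν istar / 4) :
            ℝ≥0∞)) := by
  classical
  -- Rounds from `T` on carry no assumption and do not influence the regret; making them constant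
  -- gives measurability in all rounds.
  set Y : ℕ → Ω → DelayedBandit.Outcome K := fun t => if t < T then X t else fun _ => default
    with hY
  have hXY : ∀ t < T, X t = Y t := fun t ht => by simp only [hY, if_pos ht]
  have hYm : ∀ t, Measurable (Y t) := by
    intro t
    by_cases ht : t < T
    · rw [← hXY t ht]
      exact hmeas t ht
    · simp only [hY, if_neg ht]
      exact measurable_const
  have hYlaw : ∀ t < T, P.map (Y t) = ν := fun t ht => by rw [← hXY t ht, hlaw t ht]
  have hYind : iIndepFun (fun t : Fin T => Y t) P := by
    have : (fun t : Fin T => Y t) = fun t : Fin T => X t := funext fun t => (hXY t t.2).symm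
    rw [this]
    exact hindep
  rw [DelayedBandit.opseRegret_congr hXY]
  have hL : 0 < Real.log T := Real.log_pos (by exact_mod_cast hT)
  by_cases hpos : ∀ i, i ≠ istar → 0 < DelayedBandit.gap ν istar i
  swap
  · push Not at hpos
    obtain ⟨i, hi, hle⟩ := hpos
    have htop : ∑ i ∈ Finset.univ.erase istar,
        ENNReal.ofReal (1166 * Real.log T) / ENNReal.ofReal (DelayedBandit.gap ν istar i) = ⊤ := by
      refine ENNReal.sum_eq_top.2 ⟨i, Finset.mem_erase.2 ⟨hi, Finset.mem_univ i⟩, ?_⟩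
      rw [ENNReal.ofReal_of_nonpos hle, ENNReal.div_zero]
      simpa using hL
    rw [htop, top_add]
    exact le_top
  -- With a single arm there is no suboptimal arm to absorb the 2K, but every gap is 0 and so is the
  -- regret.
  by_cases hK : K < 2
  · have hone : K = 1 := by have := NeZero.pos K; omega
    subst hone
    rw [DelayedBandit.opseRegret_eq hreward hYm hYlaw hYind hstar]
    simp [DelayedBandit.gap, Subsingleton.elim _ istar]
  rw [not_lt] at hK
  have hlogK : 0 < 4 * Real.log K := by
    have := Real.log_pos (show (1 : ℝ) < K by exact_mod_cast hK)
    linarith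
  -- Needed because 0 * ∞ = 0: an infinite quantile makes the right side infinite only if its factor
  -- is positive.
  have hlogK' : ENNReal.ofReal (4 * Real.log K) ≠ 0 := by
    rw [ne_eq, ENNReal.ofReal_eq_zero, not_le]
    exact hlogK
  set Q : ℕ∞ := ⨆ (i : Fin K) (_ : i ≠ istar),
    DelayedBandit.delayQuantile ν i (1 - DelayedBandit.gap ν istar i / 4) with hQ
  set Qs : ℕ∞ := DelayedBandit.delayQuantile ν istar (1 - DelayedBandit.minGap ν istar / 4) with hQs
  by_cases hQtop : Q = ⊤
  · rw [hQtop, ENat.toENNReal_top, top_add, ENNReal.mul_top hlogK', add_top]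
    exact le_top
  by_cases hQstop : Qs = ⊤
  · rw [hQstop, ENat.toENNReal_top, add_top, ENNReal.mul_top hlogK', add_top]
    exact le_top
  have hQi : ∀ i, i ≠ istar →
      DelayedBandit.delayQuantile ν i (1 - DelayedBandit.gap ν istar i / 4) ≤ Q := fun i hi =>
    le_iSup₂ (f := fun (i : Fin K) (_ : i ≠ istar) =>
      DelayedBandit.delayQuantile ν i (1 - DelayedBandit.gap ν istar i / 4)) i hi
  have hQi' : ∀ i, i ≠ istar →
      DelayedBandit.delayQuantile ν i (1 - DelayedBandit.gap ν istar i / 4) ≠ ⊤ := fun i hi =>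
    ne_top_of_le_ne_top hQtop (hQi i hi)
  set D : Fin K → ℕ := fun i => if i = istar then Qs.toNat else
    (DelayedBandit.delayQuantile ν i (1 - DelayedBandit.gap ν istar i / 4)).toNat with hD
  have hDs : D istar = Qs.toNat := by simp [hD]
  have hDi : ∀ i, i ≠ istar → D i =
      (DelayedBandit.delayQuantile ν i (1 - DelayedBandit.gap ν istar i / 4)).toNat :=
    fun i hi => by simp [hD, hi]
  have hmain := DelayedBandit.opseRegret_le (P := P) (istar := istar) hK hT hreward hYm hYlaw hYind
    hstar hord hpos (D := D) (M := Q.toNat)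
    (fun i hi => by
      rw [hDi i hi]
      have := DelayedBandit.delay_gt_toNat_le (hQi' i hi)
      linarith)
    (fun i hi => by
      rw [hDs]
      have h1 := DelayedBandit.delay_gt_toNat_le hQstop
      have h2 : DelayedBandit.minGap ν istar ≤ DelayedBandit.gap ν istar i :=
        ciInf_le (f := fun i : {i : Fin K // i ≠ istar} => DelayedBandit.gap ν istar i)
          (Set.finite_range _).bddBelow ⟨i, hi⟩
      linarith)
    (fun i hi => by
      rw [hDi i hi]
      exact ENat.toNat_le_toNat (hQi i hi) hQtop)
  refine (ENNReal.ofReal_le_ofReal hmain).trans (le_of_eq ?_)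
  have hterm : ∀ i ∈ Finset.univ.erase istar,
      0 ≤ 1166 * Real.log T / DelayedBandit.gap ν istar i := fun i hi => by
    have := hpos i (Finset.mem_erase.1 hi).1
    positivity
  rw [ENNReal.ofReal_add (Finset.sum_nonneg hterm) (by positivity),
    ENNReal.ofReal_sum_of_nonneg hterm, ENNReal.ofReal_mul hlogK.le, ENNReal.ofReal_natCast, hDs]
  congr 1
  · exact Finset.sum_congr rfl fun i hi =>
      ENNReal.ofReal_div_of_pos (hpos i (Finset.mem_erase.1 hi).1)
  · congr 1
    rw [Nat.cast_add, ← ENat.toENNReal_coe, ← ENat.toENNReal_coe, ENat.natCast_toNat hQtop,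
      ENat.natCast_toNat hQstop]
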